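/- All graphs are finite and simple. For a vertex $v$ of a graph $G$, the local complementation $\tau_v(G)$ is the graph obtained from $G$ by replacing the induced subgraph $G[N_v]$ on the neighborhood $N_v$ of $v$ by its complement. A graph $\tilde H$ is a vertex-minor of $G$, written $\tilde H<G$, if some finite sequence of local complementations and vertex deletions takes $G$ to $\tilde H$. ISO-VERTEXMINOR is the following decision problem: given graphs $G$ and $H$ (encoded by their adjacency matrices), decide whether there is a graph $\tilde H$ that is isomorphic to $H$ and satisfies $\tilde H<G$. **Theorem.** ISO-VERTEXMINOR is in NP. That is, there are a polynomial $p$ and a polynomial-time Turing machine that decides a predicate $V(x,w)$ on pairs of strings such that, for every string $x$: $x$ is the encoding of a pair $(G,H)$ for which $G$ has a vertex-minor isomorphic to $H$ if and only if there is a string $w$ with $|w|\le p(|x|)$ for which $V(x,w)$ holds. -/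

import Mathlib

open Classical in
/-- The adjacency matrix of a graph on `{0, …, n - 1}` written row by row over the alphabet
`{0, 1, #}`, where `some false`, `some true`, `none` stand for `0`, `1`, `#`.
Each row is followed by one `#`, and the matrix by a further `#`. -/
noncomputable def encodeGraph {n : ℕ} (G : SimpleGraph (Fin n)) : List (Option Bool) :=
  ((List.finRange n).flatMap fun i =>
    ((List.finRange n).map fun j => some (decide (G.Adj i j))) ++ [none]) ++ [none]

/-- Local complementation at `v`: the induced subgraph on the neighbourhood of `v` is replaced by
its complement, and all other adjacencies are kept. -/
def SimpleGraph.localComplement {V : Type*} (G : SimpleGraph V) (v : V) : SimpleGraph V where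
  Adj u w := u ≠ w ∧ Xor (G.Adj u w) (G.Adj v u ∧ G.Adj v w)
  symm := ⟨fun u w h => ⟨h.1.symm, by
    have h2 := h.2
    rwa [G.adj_comm u w, and_comm (a := G.Adj v u)] at h2⟩⟩
  loopless := ⟨fun _ h => h.1 rfl⟩

/-- `G.IsVertexMinor H`, for a graph `G` on `V` and a graph `H` on a subset `S` of `V`: some
finite sequence of local complementations and vertex deletions takes `G` to `H`. -/
inductive SimpleGraph.IsVertexMinor {V : Type*} (G : SimpleGraph V) :
    {S : Set V} → SimpleGraph S → Prop
  | refl : G.IsVertexMinor (G.induce Set.univ)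
  | localComplement {S : Set V} {H : SimpleGraph S} (v : S) :
      G.IsVertexMinor H → G.IsVertexMinor (H.localComplement v)
  | delete {S : Set V} {H : SimpleGraph S} (v : S) :
      G.IsVertexMinor H →
        G.IsVertexMinor
          (H.comap (Set.inclusion (Set.sdiff_subset : S \ {(v : V)} ⊆ S)))

/-- Some graph isomorphic to `H` is a vertex-minor of `G`. -/
def SimpleGraph.HasIsoVertexMinor {V W : Type*} (G : SimpleGraph V) (H : SimpleGraph W) : Prop :=
  ∃ (S : Set V) (H' : SimpleGraph S), Nonempty (H ≃g H') ∧ G.IsVertexMinor H'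

/-- The decision problem ISO-VERTEXMINOR as a language: the encodings of all pairs `(G, H)` of
finite simple graphs such that `G` has a vertex-minor isomorphic to `H`. -/
noncomputable def isoVertexMinor : Language (Option Bool) :=
  {x | ∃ (n m : ℕ) (G : SimpleGraph (Fin n)) (H : SimpleGraph (Fin m)),
    x = encodeGraph G ++ encodeGraph H ∧ G.HasIsoVertexMinor H}

/-- An input `x` and a certificate `w` written as one string over the disjoint union of their
alphabets. -/
def encodeInputCert {Γ Δ : Type} (q : List Γ × List Δ) : List (Γ ⊕ Δ) :=
  q.1.map Sum.inl ++ q.2.map Sum.inr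

/-- The class NP, through deterministic polynomial-time verifiers: `L` is in NP if there are a
polynomial `p` and a predicate `f` on pairs (input, certificate), decided by a (multi-stack)
Turing machine with finite alphabets in time polynomial in the length of the pair, such that
`x ∈ L` exactly when `f` accepts `x` with some certificate of length at most `p |x|`. -/
def InNP {Γ : Type} [Finite Γ] (L : Language Γ) : Prop :=
  ∃ (Δ : Type) (_ : Finite Δ) (p : Polynomial ℕ) (f : List Γ × List Δ → Bool),
    (∃ M : Turing.TM2ComputableInPolyTime encodeInputCert Computability.encodeBool f,
      ∀ k, Finite (M.tm.Γ k)) ∧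
    ∀ x : List Γ, x ∈ L ↔ ∃ w : List Δ, w.length ≤ p.eval x.length ∧ f (x, w) = true

/-!
Deletions can be postponed, so every vertex-minor of a graph `G` on `n` vertices is an induced
subgraph of a graph that arises from `G` by local complementations alone
(`SimpleGraph.IsVertexMinor.exists_localComplements`). The number of local complementations needed
is not bounded by the definition, but at most `2 * n` suffice
(`LocalEquivalence.exists_short_word`), and so a short list of instructions certifies membership.

The bound `2 * n` comes from isotropic systems. With adjacency matrix `A` over the field with two
elements, associate to `G` the space of pairs `(p, q)` with `q = A p`, whose members are maps from the
vertices to a plane. A local complementation changes this space only by an automorphism of the plane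
at each vertex, and hence so does a word of local complementations. If these automorphisms all fix
the direction `(0, 1)`, the graph is unchanged (`LocalEquivalence.Linked.eq`). Otherwise, let `D` be
the set of vertices where the direction is moved. A local complementation at a suitable vertex of
`D`, preceded if need be by one at a neighbour of it in `D`, removes a vertex from `D`
(`LocalEquivalence.Linked.exists_short`).

A certificate is a sequence of words with one letter for each vertex of the current graph. According
to the command that follows it, a word complements the edges within a set of vertices, performs a
local complementation, exchanges two vertices, or deletes vertices. First the graph `G` is built from
the empty graph and compared with the input, then it is transformed into `H` and compared again. Every
word acts on the adjacency matrix entry by entry: the new entry in row `u` and column `w` depends only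
on the old one and on the letters of `u` and `w`. Words that mark a vertex carry the neighbourhood of
it in their letters, and the entries of its row and column are checked against them. Thus the verifier
only has to go through the matrix and the word in parallel, which stacks allow, and each word takes
quadratic time (`VertexMinorCertificate.exec_verifier`). Soundness rests on an invariant of the
verification (`VertexMinorCertificate.Invariant`), and completeness on writing down the instructions
(`VertexMinorCertificate.exists_certificate`).

The verifier is written in a small language of structured programs with a big-step semantics that
counts steps; `StackProgram.exists_polyTime` compiles such programs to multi-stack Turing machines.
-/

/-! ### Vertex-minors and words of local complementations -/

namespace SimpleGraph

variable {V : Type*}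

/-- The graph obtained from `G` by local complementations at the vertices of a word. -/
def localComplements (G : SimpleGraph V) (w : List V) : SimpleGraph V :=
  w.foldl localComplement G

theorem localComplements_append (G : SimpleGraph V) (w w' : List V) :
    G.localComplements (w ++ w') = (G.localComplements w).localComplements w' :=
  List.foldl_append

theorem localComplement_adj (G : SimpleGraph V) (v a b : V) :
    (G.localComplement v).Adj a b ↔ a ≠ b ∧ Xor (G.Adj a b) (G.Adj v a ∧ G.Adj v b) := Iff.rfl

theorem localComplement_adj_self (G : SimpleGraph V) (v a : V) :
    (G.localComplement v).Adj v a ↔ G.Adj v a := by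
  rw [localComplement_adj]
  by_cases h : v = a
  · subst h; simp
  · simp [h, Xor]

theorem localComplement_localComplement (G : SimpleGraph V) (v : V) :
    (G.localComplement v).localComplement v = G := by
  ext a b
  rw [localComplement_adj, localComplement_adj_self, localComplement_adj_self,
    localComplement_adj]
  have := fun h : G.Adj a b => h.ne
  by_cases h1 : G.Adj a b <;> by_cases h2 : G.Adj v a <;> by_cases h3 : G.Adj v b <;>
    simp_all

theorem induce_localComplement (G : SimpleGraph V) (S : Set V) (v : S) :
    (G.induce S).localComplement v = (G.localComplement v).induce S := by
  ext a b
  simp [localComplement_adj, Subtype.ext_iff]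

/-- Deletions may be postponed: a vertex-minor is an induced subgraph of a graph obtained by local
complementations alone. -/
theorem IsVertexMinor.exists_localComplements {G : SimpleGraph V} {S : Set V} {H : SimpleGraph S}
    (h : G.IsVertexMinor H) : ∃ w : List V, H = (G.localComplements w).induce S := by
  induction h with
  | refl => exact ⟨[], rfl⟩
  | localComplement v _ ih =>
    obtain ⟨w, rfl⟩ := ih
    exact ⟨w ++ [(v : V)], by rw [localComplements_append, induce_localComplement]; rfl⟩
  | delete v _ ih =>
    obtain ⟨w, rfl⟩ := ih
    exact ⟨w, rfl⟩

theorem isVertexMinor_localComplements_univ (G : SimpleGraph V) (w : List V) :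
    G.IsVertexMinor ((G.localComplements w).induce Set.univ) := by
  induction w using List.reverseRecOn with
  | nil => exact .refl
  | append_singleton w v ih =>
    have := ih.localComplement ⟨v, Set.mem_univ v⟩
    rw [induce_localComplement] at this
    rw [localComplements_append]
    exact this

theorem isVertexMinor_localComplements [Finite V] (G : SimpleGraph V) (w : List V) (S : Set V) :
    G.IsVertexMinor ((G.localComplements w).induce S) := by
  suffices h : ∀ T : Set V, T.Finite → ∀ S, S = Tᶜ →
      G.IsVertexMinor ((G.localComplements w).induce S) from
    h Sᶜ (Set.toFinite _) S (compl_compl S).symm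
  intro T hT
  induction T, hT using Set.Finite.induction_on with
  | empty =>
    rintro S rfl
    rw [Set.compl_empty]
    exact isVertexMinor_localComplements_univ G w
  | @insert v T hv _ ih =>
    intro S hS
    have h : S = Tᶜ \ {v} := by rw [hS]; ext; simp; tauto
    subst h
    exact (ih _ rfl).delete ⟨v, hv⟩

end SimpleGraph

namespace LocalEquivalence

open SimpleGraph

/-- The plane over the field with two elements. -/
abbrev Plane := ZMod 2 × ZMod 2

variable {V : Type*}

open Classical in
/-- The change of coordinates in the plane of `u` that accompanies local complementation at `v`. -/
noncomputable def shear (G : SimpleGraph V) (v u : V) (y : Plane) : Plane :=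
  if u = v then (y.1 + y.2, y.2) else if G.Adj v u then (y.1, y.2 + y.1) else y

theorem shear_shear (G : SimpleGraph V) (v u : V) (y : Plane) :
    shear G v u (shear G v u y) = y := by
  have h : ∀ a b : ZMod 2, a + b + b = a := by decide
  unfold shear
  split_ifs <;> simp [h]

theorem shear_add (G : SimpleGraph V) (v u : V) (y z : Plane) :
    shear G v u (y + z) = shear G v u y + shear G v u z := by
  unfold shear
  split_ifs <;> ext <;> simp <;> ring

theorem shear_localComplement (G : SimpleGraph V) (v : V) :
    shear (G.localComplement v) v = shear G v := by
  funext u y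
  have := localComplement_adj_self G v u
  unfold shear
  by_cases h : G.Adj v u
  · rw [if_pos h, if_pos (this.2 h)]
  · rw [if_neg h, if_neg (mt this.1 h)]

variable [Fintype V]

open Classical in
/-- The neighbourhood sum `∑_{u ∼ v} p u`, which is the product of the adjacency matrix with `p`. -/
noncomputable def nsum (G : SimpleGraph V) (p : V → ZMod 2) (v : V) : ZMod 2 :=
  ∑ u, if G.Adj v u then p u else 0

/-- The isotropic system of a graph: the pairs `(p, q)` of vectors with `q = A p`, where `A` is the
adjacency matrix. -/
def isotropic (G : SimpleGraph V) : Set (V → Plane) :=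
  {x | ∀ v, (x v).2 = nsum G (fun u => (x u).1) v}

/-- Local complementation at `v` changes the isotropic system only by the coordinate changes
`shear`. -/
theorem shear_mem_isotropic (G : SimpleGraph V) (v : V) {x : V → Plane} (hx : x ∈ isotropic G) :
    (fun u => shear G v u (x u)) ∈ isotropic (G.localComplement v) := by
  classical
  intro u
  have hq := fun u => hx u
  simp only [nsum] at hq ⊢
  have hfst : ∀ t, (shear G v t (x t)).1 = (x t).1 + if t = v then (x v).2 else 0 := by
    intro t
    unfold shear
    split_ifs <;> simp_all
  simp only [hfst]
  have split : ∀ t, (if (G.localComplement v).Adj u t then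
        (x t).1 + (if t = v then (x v).2 else 0) else 0) =
      (if G.Adj u t then (x t).1 else 0) +
      (if t = v then (if G.Adj v u then (x v).2 else 0) else 0) +
      ((if G.Adj v u then (if G.Adj v t then (x t).1 else 0) else 0) +
      (if t = u then (if G.Adj v u then (x u).1 else 0) else 0)) := by
    intro t
    have c : ∀ a : ZMod 2, a + a = 0 := by decide
    rw [localComplement_adj]
    by_cases htv : t = v
    · subst htv
      by_cases hut : u = t
      · subst hut; simp
      · simp [hut, Ne.symm hut, G.adj_comm u t]
        by_cases h : G.Adj t u <;> simp [h]
    · by_cases htu : t = u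
      · subst htu
        by_cases h : G.Adj v t <;> simp [h, htv, c]
      · by_cases h1 : G.Adj u t <;> by_cases h2 : G.Adj v u <;> by_cases h3 : G.Adj v t <;>
          simp [h1, h2, h3, htv, htu, Ne.symm htu, c]
  rw [Finset.sum_congr rfl fun t _ => split t]
  simp only [Finset.sum_add_distrib, Finset.sum_ite_eq', Finset.mem_univ, if_true]
  rw [← hq u]
  have c : ∀ a b : ZMod 2, a + a + b = b := by decide
  by_cases huv : u = v
  · subst huv
    simp [shear]
  · by_cases h : G.Adj v u
    · have c' : ∀ a b d: ZMod 2, a + b = a + d + (d + b) := by decide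
      simp only [shear, huv, h, if_true, if_false]
      rw [← hq v]
      exact c' _ _ _
    · simp [shear, huv, h]

open Classical in
/-- The member of the isotropic system that corresponds to the vertex `v`. -/
noncomputable def generator (G : SimpleGraph V) (v : V) (u : V) : Plane :=
  (if u = v then 1 else 0, if G.Adj v u then 1 else 0)

theorem generator_mem_isotropic (G : SimpleGraph V) (v : V) : generator G v ∈ isotropic G := by
  classical
  intro u
  simp only [nsum, generator]
  rw [Finset.sum_congr rfl (g := fun t => if t = v then (if G.Adj u v then 1 else 0) else 0)]
  · simp [G.adj_comm u v]
  · intro t _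
    by_cases h : t = v
    · subst h; simp
    · simp [h]

/-- The coordinate changes `g` carry the isotropic system of `G` into that of `G'`. -/
def Linked (G G' : SimpleGraph V) (g : V → Plane ≃+ Plane) : Prop :=
  ∀ x ∈ isotropic G, (fun v => g v (x v)) ∈ isotropic G'

/-- The coordinate change `shear` as an automorphism. -/
noncomputable def shearEquiv (G : SimpleGraph V) (v u : V) : Plane ≃+ Plane where
  toFun := shear G v u
  invFun := shear G v u
  left_inv := shear_shear G v u
  right_inv := shear_shear G v u
  map_add' := shear_add G v u

theorem exists_linked (G : SimpleGraph V) (w : List V) :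
    ∃ g, Linked G (G.localComplements w) g := by
  induction w generalizing G with
  | nil => exact ⟨fun _ => AddEquiv.refl _, fun x hx => hx⟩
  | cons v w ih =>
    obtain ⟨g, hg⟩ := ih (G.localComplement v)
    exact ⟨fun u => (shearEquiv G v u).trans (g u),
      fun x hx => hg _ (shear_mem_isotropic G v hx)⟩

theorem Linked.localComplement {G G' : SimpleGraph V} {g : V → Plane ≃+ Plane}
    (h : Linked G G' g) (v : V) :
    Linked (G.localComplement v) G' fun u => (shearEquiv G v u).trans (g u) := by
  intro x hx
  have := shear_mem_isotropic _ v hx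
  rw [localComplement_localComplement, shear_localComplement] at this
  exact h _ this

/-- If the coordinate changes fix the direction `(0, 1)` everywhere, they do not change the graph:
the image of the generator of `v` has first components `0` except at `v`, so its second components are
both the row of `v` in the new adjacency matrix and, away from `v`, the old row. -/
theorem Linked.eq {G G' : SimpleGraph V} {g : V → Plane ≃+ Plane} (h : Linked G G' g)
    (hg : ∀ v, g v (0, 1) = (0, 1)) : G = G' := by
  classical
  ext v u
  by_cases huv : u = v
  · subst huv; simp
  have hm := h _ (generator_mem_isotropic G v)
  have hfst : ∀ t, (g t (generator G v t)).1 = if t = v then 1 else 0 := by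
    intro t
    have key : ∀ f : Plane ≃+ Plane, f (0, 1) = (0, 1) → (f (1, 0)).1 = 1 := by
      intro f hf
      have h0 : f (1, 0) ≠ f (0, 1) := fun e => by simpa using f.injective e
      have h1 : f (1, 0) ≠ f 0 := fun e => by simpa using f.injective e
      rw [hf] at h0
      rw [map_zero] at h1
      have : ∀ y : Plane, y ≠ (0, 1) → y ≠ 0 → y.1 = 1 := by decide
      exact this _ h0 h1
    by_cases ht : t = v
    · subst ht
      simp only [generator, if_true, G.irrefl, if_false]
      exact key _ (hg t)
    · simp only [generator, ht, if_false]
      by_cases ha : G.Adj v t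
      · simp [ha, hg]
      · simp only [ha, if_false]
        exact congrArg Prod.fst (map_zero (g t))
  have := hm u
  simp only [nsum, hfst] at this
  rw [Finset.sum_congr rfl (g := fun t => if t = v then (if G'.Adj u v then 1 else 0) else 0)
    (fun t _ => by by_cases ht : t = v <;> simp [ht])] at this
  simp only [Finset.sum_ite_eq', Finset.mem_univ, if_true, generator, huv, if_false] at this
  rw [G'.adj_comm]
  by_cases ha : G.Adj v u
  · simp only [ha, if_true, hg] at this
    simpa [ha] using this
  · simp only [ha, if_false] at this
    rw [show ((0 : ZMod 2), (0 : ZMod 2)) = 0 from rfl, map_zero] at this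
    by_cases hc : G'.Adj u v
    · simp [hc] at this
    · simp [hc, ha]

/-- As long as `g` moves some direction `(0, 1)`, at most two local complementations reduce the
number of vertices where it does; `D` is the set of these vertices. -/
theorem Linked.exists_short {G G' : SimpleGraph V} {g : V → Plane ≃+ Plane} (h : Linked G G' g)
    {k : ℕ} {D : Finset V} (hD : ∀ v, v ∈ D ↔ g v (0, 1) ≠ (0, 1)) (hk : D.card = k) :
    ∃ w : List V, w.length ≤ 2 * k ∧ G.localComplements w = G' := by
  classical
  induction k generalizing G g D with
  | zero =>
    rw [Finset.card_eq_zero] at hk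
    subst hk
    exact ⟨[], by simp, h.eq fun v => by simpa using hD v⟩
  | succ k ih =>
    have sh_self : ∀ (G : SimpleGraph V) v, shearEquiv G v v (0, 1) = (1, 1) := by
      intro G v; simp [shearEquiv, shear]
    have sh_ne : ∀ (G : SimpleGraph V) v u, u ≠ v → shearEquiv G v u (0, 1) = (0, 1) := by
      intro G v u hu; simp [shearEquiv, shear, hu]
    -- If `g v` takes `(1, 1)` to `(0, 1)`, local complementation at `v` repairs the vertex `v`.
    have one : ∀ (G : SimpleGraph V) (g : V → Plane ≃+ Plane) (D : Finset V), Linked G G' g →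
        (∀ v, v ∈ D ↔ g v (0, 1) ≠ (0, 1)) → D.card = k + 1 → ∀ v ∈ D, g v (1, 1) = (0, 1) →
        ∃ w : List V, w.length ≤ 2 * k + 1 ∧ G.localComplements w = G' := by
      intro G g D h hD hk v hv hgv
      obtain ⟨w, hw, e⟩ := ih (h.localComplement v) (D := D.erase v) (fun u => by
        by_cases hu : u = v
        · subst hu
          simp [sh_self, hgv]
        · simp [hu, sh_ne G v u hu, hD]) (by rw [Finset.card_erase_of_mem hv, hk]; rfl)
      exact ⟨v :: w, by simpa using hw, e⟩
    -- Otherwise it takes `(1, 0)` to `(0, 1)`.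
    have third : ∀ y : Plane, y = 0 ∨ y = (0, 1) ∨ y = (1, 0) ∨ y = (1, 1) := by decide
    have pre : ∀ v ∈ D, g v (1, 1) ≠ (0, 1) → g v (1, 0) = (0, 1) := by
      intro v hv h1
      have h2 := (g v).apply_symm_apply (0, 1)
      rcases third ((g v).symm (0, 1)) with e | e | e | e <;> rw [e] at h2
      · rw [map_zero] at h2; exact absurd h2 (by decide)
      · exact absurd h2 ((hD v).1 hv)
      · exact h2
      · exact absurd h2 h1
    by_cases hc : ∃ v ∈ D, g v (1, 1) = (0, 1)
    · obtain ⟨v, hv, hgv⟩ := hc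
      obtain ⟨w, hw, e⟩ := one G g D h hD hk v hv hgv
      exact ⟨w, by omega, e⟩
    push Not at hc
    obtain ⟨v, hv⟩ : D.Nonempty := by
      rw [← Finset.card_pos]; omega
    -- The generator of `v` would be taken to a nonzero vector with first components zero if `v` had
    -- no neighbour in `D`.
    obtain ⟨u, hu, huv⟩ : ∃ u ∈ D, G.Adj v u := by
      by_contra hn
      push Not at hn
      have hm := h _ (generator_mem_isotropic G v)
      have hfst : ∀ t, (g t (generator G v t)).1 = 0 := by
        intro t
        by_cases ht : t = v
        · subst ht
          simp [generator, pre t hv (hc t hv)]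
        · by_cases ha : G.Adj v t
          · have ht' : g t (0, 1) = (0, 1) := by
              by_contra hh
              exact hn t ((hD t).2 hh) ha
            simp [generator, ht, ha, ht']
          · simp only [generator, ht, ha, if_false]
            exact congrArg Prod.fst (map_zero (g t))
      have hv2 := hm v
      simp only [nsum, hfst, ite_self, Finset.sum_const_zero] at hv2
      simp [generator, pre v hv (hc v hv)] at hv2
    -- Local complementation at the neighbour `u` brings `v` into the case covered by `one`.
    obtain ⟨w, hw, e⟩ := one (G.localComplement u) _ D (h.localComplement u) (fun t => by
        by_cases ht : t = u
        · subst ht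
          simp [sh_self, hu, hc t hu]
        · simp [sh_ne G u t ht, hD]) hk v hv (by
        have : shearEquiv G u v (1, 1) = (1, 0) := by
          simp [shearEquiv, shear, huv.ne, huv.symm]
          decide
        rw [AddEquiv.trans_apply, this]
        exact pre v hv (hc v hv))
    exact ⟨u :: w, by simp; omega, e⟩

/-- Every graph that arises from `G` by local complementations arises from at most `2 |V|` of
them. -/
theorem exists_short_word (G : SimpleGraph V) (w : List V) :
    ∃ w' : List V, w'.length ≤ 2 * Fintype.card V ∧
      G.localComplements w' = G.localComplements w := by
  classical
  obtain ⟨g, hg⟩ := exists_linked G w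
  obtain ⟨w', h, e⟩ := hg.exists_short (D := {v | g v (0, 1) ≠ (0, 1)}) (by simp) rfl
  exact ⟨w', h.trans (Nat.mul_le_mul_left 2 (Finset.card_le_univ _)), e⟩

end LocalEquivalence

/-! ### Structured programs on stacks and their compilation to Turing machines -/

namespace StackProgram

variable {J A σ : Type}

/-- Elementary operations of a program working on stacks indexed by `J` with entries in `A` and on
a register in `σ`. A `push` of `none` leaves the stack unchanged. -/
inductive Op (J A σ : Type)
  | push (j : J) (f : σ → Option A)
  | pop (j : J) (f : σ → Option A → σ)
  | load (f : σ → σ)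

/-- Structured programs. `loop l c p` runs `l`; if then `c` holds, it runs `p` and starts again,
and otherwise it ends. -/
inductive Prog (J A σ : Type)
  | ops (l : List (Op J A σ))
  | seq (p q : Prog J A σ)
  | ite (c : σ → Bool) (p q : Prog J A σ)
  | loop (l : List (Op J A σ)) (c : σ → Bool) (p : Prog J A σ)

/-- The control points of a program. -/
def Label : Prog J A σ → Type
  | .ops _ => Unit
  | .seq p q => Label p ⊕ Label q
  | .ite _ p q => Option (Label p ⊕ Label q)
  | .loop _ _ p => Option (Label p)

/-- A program has finitely many control points. -/
@[reducible]
noncomputable def labelFintype : (p : Prog J A σ) → Fintype (Label p)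
  | .ops _ => inferInstanceAs (Fintype Unit)
  | .seq p q =>
    letI := labelFintype p
    letI := labelFintype q
    inferInstanceAs (Fintype (Label p ⊕ Label q))
  | .ite _ p q =>
    letI := labelFintype p
    letI := labelFintype q
    inferInstanceAs (Fintype (Option (Label p ⊕ Label q)))
  | .loop _ _ p =>
    letI := labelFintype p
    inferInstanceAs (Fintype (Option (Label p)))

/-- The control point where a program starts. -/
def entry : (p : Prog J A σ) → Label p
  | .ops _ => ()
  | .seq p _ => Sum.inl (entry p)
  | .ite _ _ _ => none
  | .loop _ _ _ => none

variable [DecidableEq J]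

/-- The effect of an elementary operation on the register and the stacks. -/
def Op.run : Op J A σ → σ × (J → List A) → σ × (J → List A)
  | .push j f, s => (s.1, Function.update s.2 j ((f s.1).toList ++ s.2 j))
  | .pop j f, s => (f s.1 (s.2 j).head?, Function.update s.2 j (s.2 j).tail)
  | .load f, s => (f s.1, s.2)

/-- The effect of a list of elementary operations. -/
def runOps (l : List (Op J A σ)) (s : σ × (J → List A)) : σ × (J → List A) :=
  l.foldl (fun s o => o.run s) s

/-- `Exec p s s' t`: the program `p` takes the state `s` to the state `s'` in at most `t` steps. -/
inductive Exec : Prog J A σ → σ × (J → List A) → σ × (J → List A) → ℕ → Prop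
  | ops (l s) : Exec (.ops l) s (runOps l s) 1
  | seq {p q s s' s'' a b} : Exec p s s' a → Exec q s' s'' b → Exec (.seq p q) s s'' (a + b)
  | ite_true {c p q s s' a} : c s.1 = true → Exec p s s' a → Exec (.ite c p q) s s' (a + 1)
  | ite_false {c p q s s' a} : c s.1 = false → Exec q s s' a → Exec (.ite c p q) s s' (a + 1)
  | loop_exit {l c p s} : c (runOps l s).1 = false → Exec (.loop l c p) s (runOps l s) 1
  | loop_iter {l c p s s' s'' a b} : c (runOps l s).1 = true → Exec p (runOps l s) s' a →
      Exec (.loop l c p) s' s'' b → Exec (.loop l c p) s s'' (a + b + 1)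
  | weaken {p s s' a b} : a ≤ b → Exec p s s' a → Exec p s s' b

theorem Exec.of_ops {l : List (Op J A σ)} {s s' : σ × (J → List A)} (h : runOps l s = s') :
    Exec (.ops l) s s' 1 :=
  h ▸ .ops l s

theorem Exec.of_loop_exit {l : List (Op J A σ)} {c : σ → Bool} {p : Prog J A σ}
    {s s' : σ × (J → List A)} (h : runOps l s = s') (hc : c s'.1 = false) :
    Exec (.loop l c p) s s' 1 := by
  subst h
  exact .loop_exit hc

theorem Exec.of_loop_iter {l : List (Op J A σ)} {c : σ → Bool} {p : Prog J A σ}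
    {s s₁ s₂ s₃ : σ × (J → List A)} {a b t : ℕ} (h : runOps l s = s₁) (hc : c s₁.1 = true)
    (hp : Exec p s₁ s₂ a) (hl : Exec (.loop l c p) s₂ s₃ b) (ht : a + b + 1 ≤ t) :
    Exec (.loop l c p) s s₃ t := by
  subst h
  exact (Exec.loop_iter hc hp hl).weaken ht

/-- The stack alphabets of the compiled machine: there is one more stack `none`, which holds the
answer, a Boolean. -/
abbrev Alphabet (J A : Type) : Option J → Type
  | none => Bool
  | some _ => A

/-- The stacks of the compiled machine while the answer stack is empty. -/
def liftStacks (S : J → List A) : ∀ k, List (Alphabet J A k)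
  | none => []
  | some j => S j

open Turing

/-- The machine statement that performs a list of elementary operations and goes on with `q`. -/
def opsCode [Inhabited A] {L : Type} :
    List (Op J A σ) → TM2.Stmt (Alphabet J A) L σ → TM2.Stmt (Alphabet J A) L σ
  | [], q => q
  | .push j f :: l, q =>
    .branch (fun v => (f v).isSome)
      (.push (some j) (fun v => (f v).getD default) (opsCode l q)) (opsCode l q)
  | .pop j f :: l, q => .pop (some j) f (opsCode l q)
  | .load f :: l, q => .load f (opsCode l q)

/-- The machine code of a program whose control points are embedded by `emb` into the labels of a
machine, and which continues at the label given next. -/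
def code [Inhabited A] {L : Type} :
    (p : Prog J A σ) → (Label p → L) → L → Label p → TM2.Stmt (Alphabet J A) L σ
  | .ops l, _, next, _ => opsCode l (.goto fun _ => next)
  | .seq p q, emb, _, .inl a => code p (emb ∘ Sum.inl) (emb (.inr (entry q))) a
  | .seq _ q, emb, exit, .inr a => code q (emb ∘ Sum.inr) exit a
  | .ite c p q, emb, _, none =>
    .branch c (.goto fun _ => emb (some (.inl (entry p))))
      (.goto fun _ => emb (some (.inr (entry q))))
  | .ite _ p _, emb, exit, some (.inl a) => code p (emb ∘ some ∘ Sum.inl) exit a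
  | .ite _ _ q, emb, exit, some (.inr a) => code q (emb ∘ some ∘ Sum.inr) exit a
  | .loop l c p, emb, exit, none =>
    opsCode l (.branch c (.goto fun _ => emb (some (entry p))) (.goto fun _ => exit))
  | .loop _ _ p, emb, _, some a => code p (emb ∘ some) (emb none) a

theorem update_liftStacks (S : J → List A) (j : J) (x : List A) :
    Function.update (liftStacks S) (some j) x = liftStacks (Function.update S j x) := by
  funext k
  rcases k with _ | k
  · simp [liftStacks]
  · by_cases h : k = j
    · subst h; simp [liftStacks]
    · have h' : (some k) ≠ some j := by simpa using h
      rw [Function.update_of_ne h']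
      simp [liftStacks, h]

theorem stepAux_opsCode [Inhabited A] {L : Type} (l : List (Op J A σ))
    (q : TM2.Stmt (Alphabet J A) L σ) (v : σ) (S : J → List A) :
    TM2.stepAux (opsCode l q) v (liftStacks S) =
      TM2.stepAux q (runOps l (v, S)).1 (liftStacks (runOps l (v, S)).2) := by
  induction l generalizing v S with
  | nil => rfl
  | cons o l ih =>
    rcases o with ⟨j, f⟩ | ⟨j, f⟩ | f
    · rw [opsCode, TM2.stepAux, TM2.stepAux]
      rcases h : f v with _ | a
      · simp only [Option.isSome_none, cond_false]
        rw [ih]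
        simp [runOps, Op.run, h]
      · simp only [Option.isSome_some, cond_true, Option.getD_some]
        rw [update_liftStacks, ih]
        simp [runOps, Op.run, h, liftStacks]
    · rw [opsCode, TM2.stepAux, update_liftStacks, ih]
      rfl
    · rw [opsCode, TM2.stepAux, ih]
      rfl

/-- `Steps m c c' t`: the machine `m` goes from `c` to `c'` in at most `t` steps. -/
def Steps {L : Type} (m : L → TM2.Stmt (Alphabet J A) L σ)
    (c c' : TM2.Cfg (Alphabet J A) L σ) (t : ℕ) : Prop :=
  Nonempty (StateTransition.EvalsToInTime (TM2.step m) c (some c') t)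

theorem Steps.trans {L : Type} {m : L → TM2.Stmt (Alphabet J A) L σ}
    {c c' c'' : TM2.Cfg (Alphabet J A) L σ} {a b : ℕ} (h : Steps m c c' a)
    (h' : Steps m c' c'' b) : Steps m c c'' (a + b) := by
  obtain ⟨h⟩ := h
  obtain ⟨h'⟩ := h'
  exact ⟨Nat.add_comm b a ▸ h.trans _ _ _ _ _ _ h'⟩

theorem Steps.weaken {L : Type} {m : L → TM2.Stmt (Alphabet J A) L σ}
    {c c' : TM2.Cfg (Alphabet J A) L σ} {a b : ℕ} (hab : a ≤ b) (h : Steps m c c' a) :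
    Steps m c c' b := by
  obtain ⟨h⟩ := h
  exact ⟨⟨h.toEvalsTo, h.steps_le_m.trans hab⟩⟩

theorem Steps.one {L : Type} {m : L → TM2.Stmt (Alphabet J A) L σ} {l : L}
    {q : TM2.Stmt (Alphabet J A) L σ} (hq : m l = q) {v : σ} {S : ∀ k, List (Alphabet J A k)}
    {c : TM2.Cfg (Alphabet J A) L σ} (hc : TM2.stepAux q v S = c) :
    Steps m ⟨some l, v, S⟩ c 1 := by
  subst hq hc
  exact ⟨⟨⟨1, rfl⟩, le_rfl⟩⟩

theorem stepAux_branch_true {L : Type} {c : σ → Bool} {q q' : TM2.Stmt (Alphabet J A) L σ} {v : σ}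
    {S : ∀ k, List (Alphabet J A k)} (h : c v = true) :
    TM2.stepAux (.branch c q q') v S = TM2.stepAux q v S := by
  rw [TM2.stepAux, h, cond_true]

theorem stepAux_branch_false {L : Type} {c : σ → Bool} {q q' : TM2.Stmt (Alphabet J A) L σ}
    {v : σ} {S : ∀ k, List (Alphabet J A k)} (h : c v = false) :
    TM2.stepAux (.branch c q q') v S = TM2.stepAux q' v S := by
  rw [TM2.stepAux, h, cond_false]

/-- The compiled code of a program follows the big-step semantics, with the same time bound: every
control point is one machine statement, executed in one step. -/
theorem Exec.steps [Inhabited A] {p : Prog J A σ} {s s' : σ × (J → List A)} {t : ℕ}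
    (h : Exec p s s' t) {L : Type} (m : L → TM2.Stmt (Alphabet J A) L σ) (emb : Label p → L)
    (exit : L) (hm : ∀ a, m (emb a) = code p emb exit a) :
    Steps m ⟨some (emb (entry p)), s.1, liftStacks s.2⟩ ⟨some exit, s'.1, liftStacks s'.2⟩ t := by
  induction h generalizing exit with
  | ops l s => exact Steps.one (hm ()) (stepAux_opsCode _ _ _ _)
  | seq _ _ ih ih' =>
    exact (ih (emb ∘ Sum.inl) _ fun a => hm (.inl a)).trans
      (ih' (emb ∘ Sum.inr) _ fun a => hm (.inr a))
  | @ite_true c p q s s' a hc _ ih =>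
    rw [Nat.add_comm]
    exact (Steps.one (hm none) (stepAux_branch_true hc)).trans
      (ih (emb ∘ some ∘ Sum.inl) _ fun a => hm (some (.inl a)))
  | @ite_false c p q s s' a hc _ ih =>
    rw [Nat.add_comm]
    exact (Steps.one (hm none) (stepAux_branch_false hc)).trans
      (ih (emb ∘ some ∘ Sum.inr) _ fun a => hm (some (.inr a)))
  | @loop_exit l c p s hc =>
    exact Steps.one (hm none) ((stepAux_opsCode _ _ _ _).trans (stepAux_branch_false hc))
  | @loop_iter l c p s s' s'' a b hc _ _ ih ih' =>
    rw [Nat.add_comm]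
    exact (Steps.one (hm none) ((stepAux_opsCode _ _ _ _).trans (stepAux_branch_true hc))).trans
      (Steps.trans (ih (emb ∘ some) _ fun a => hm (some a)) (ih' emb exit hm))
  | weaken hab _ ih => exact (ih emb exit hm).weaken hab

/-- The machine that runs `p`, starting with register `v₀` and its input on stack `j₀`, and then
pushes the answer `res` and halts. -/
noncomputable def machine [Fintype J] [Inhabited A] [Fintype A] [Fintype σ] (p : Prog J A σ)
    (j₀ : J) (v₀ : σ) (res : σ → Bool) : FinTM2 where
  K := Option J
  k₀ := some j₀
  k₁ := none
  Γ := Alphabet J A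
  Λ := Option (Label p)
  main := some (entry p)
  ΛFin := letI := labelFintype p; inferInstance
  σ := σ
  initialState := v₀
  Γk₀Fin := inferInstanceAs (Fintype A)
  m
    | some a => code p some none a
    | none => .push none res (.load (fun _ => v₀) .halt)

/-- A program that, within polynomial time, computes `f` in its register and empties its stacks
yields a polynomial-time machine that computes `f`. -/
theorem exists_polyTime [Fintype J] [Inhabited A] [Fintype A] [Fintype σ] (p : Prog J A σ)
    (j₀ : J) (v₀ : σ) (res : σ → Bool) {α : Type} (enc : α → List A) (f : α → Bool)
    (T : Polynomial ℕ)
    (h : ∀ a, ∃ v, Exec p (v₀, Function.update (fun _ => []) j₀ (enc a)) (v, fun _ => [])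
      (T.eval (enc a).length) ∧ res v = f a) :
    ∃ M : TM2ComputableInPolyTime enc Computability.encodeBool f, ∀ k, Finite (M.tm.Γ k) := by
  have key : ∀ a (l : List A) (l' : List Bool), l = enc a → l' = [f a] →
      Nonempty (TM2OutputsInTime (machine p j₀ v₀ res) l (some l')
        ((T + 1).eval (enc a).length)) := by
    rintro a _ _ rfl rfl
    obtain ⟨v, hv, hf⟩ := h a
    have h1 := hv.steps (machine p j₀ v₀ res).m some none (fun _ => rfl)
    -- One more step pushes the answer, resets the register and halts.
    have h3 := h1.trans (Steps.one (rfl : (machine p j₀ v₀ res).m none = _) rfl)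
    rw [Polynomial.eval_add, Polynomial.eval_one]
    have e1 : initList (machine p j₀ v₀ res) (enc a) =
        ⟨some (some (entry p)), v₀,
          liftStacks (Function.update (fun _ => []) j₀ (enc a))⟩ := by
      unfold initList
      congr 1
      rw [← update_liftStacks]
      funext k
      by_cases hk : k = some j₀
      · subst hk
        exact (dif_pos rfl).trans (Function.update_self (some j₀) (enc a) (liftStacks _)).symm
      · refine (dif_neg hk).trans (Eq.trans ?_ (Function.update_of_ne
          (β := fun k => List (Alphabet J A k)) hk (enc a) (liftStacks fun _ => [])).symm)
        cases k <;> rfl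
    have e2 : haltList (machine p j₀ v₀ res) [f a] =
        (⟨none, v₀, Function.update (liftStacks fun _ => []) none [res v]⟩ :
          TM2.Cfg (Alphabet J A) (Option (Label p)) σ) := by
      unfold haltList
      congr 1
      funext k
      rcases k with _ | k
      · rw [← hf]
        exact (dif_pos rfl).trans
          (Function.update_self (β := fun k => List (Alphabet J A k)) none [res v]
            (liftStacks _)).symm
      · exact (dif_neg (Option.some_ne_none k)).trans
          (Function.update_of_ne (β := fun k => List (Alphabet J A k)) (Option.some_ne_none k)
            [res v] (liftStacks fun _ => [])).symm
    have h4 : Steps (machine p j₀ v₀ res).m (initList (machine p j₀ v₀ res) (enc a))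
        (haltList (machine p j₀ v₀ res) [f a]) (T.eval (enc a).length + 1) :=
      (congrArg₂ (fun c c' => Steps (machine p j₀ v₀ res).m c c' _) e1 e2).mpr h3
    exact h4
  refine ⟨⟨⟨machine p j₀ v₀ res, Equiv.refl _, Equiv.refl _⟩, T + 1, fun a => ?_⟩, ?_⟩
  · exact Classical.choice (key a _ _ (List.map_id _) (List.map_id _))
  · rintro (_ | k)
    · exact inferInstanceAs (Finite Bool)
    · exact inferInstanceAs (Finite A)

end StackProgram

/-! ### Certificates and the verification procedure -/

namespace VertexMinorCertificate

/-- The letters of the words in a certificate; a word assigns a letter to each vertex of the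
current graph. Vertices are marked by `fst` and `snd`; the others carry two bits. -/
inductive Sym
  | fst
  | snd
  | nb (a b : Bool)
  deriving DecidableEq, Fintype

/-- The ways in which a word acts on the current graph: `toggle` changes the adjacency of any two
vertices whose letters have the first bit set; `lc` is local complementation at the vertex marked
`fst`, whose neighbourhood the first bits of the others must spell out; `swap` exchanges the vertices
marked `fst` and `snd`, whose neighbourhoods the first and the second bits of the others must spell
out; `del` deletes the vertices whose letters have the first bit zero. -/
inductive Kind
  | toggle
  | lc
  | swap
  | del
  deriving DecidableEq

instance : Fintype Kind where
  elems := {.toggle, .lc, .swap, .del}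
  complete k := by cases k <;> decide

/-- The alphabet of certificates: letters of words, the command to let the word just read act on the
current graph, and the command to compare the current graph with the next graph of the input. -/
inductive Cert
  | sym (s : Sym)
  | run (k : Kind)
  | cmp
  deriving DecidableEq, Fintype

/-- The phases of the verification: no graph yet, building the first graph of the input,
transforming it, and both graphs of the input recognized. -/
inductive Phase
  | fresh
  | build
  | transform
  | done
  deriving DecidableEq

instance : Fintype Phase where
  elems := {.fresh, .build, .transform, .done}
  complete k := by cases k <;> decide

/-- The new adjacency of two distinct vertices with letters `s`, `s'` and adjacency `m`, or `none` if
the letters are not consistent with `m`. -/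
def Kind.value : Kind → Sym → Sym → Bool → Option Bool
  | .toggle, .nb a _, .nb a' _, m => some (xor m (a && a'))
  | .lc, .fst, .nb a _, m => if m = a then some m else none
  | .lc, .nb a _, .fst, m => if m = a then some m else none
  | .lc, .nb a _, .nb a' _, m => some (xor m (a && a'))
  | .swap, .fst, .nb a b, m => if m = a then some b else none
  | .swap, .nb a b, .fst, m => if m = a then some b else none
  | .swap, .snd, .nb a b, m => if m = b then some a else none
  | .swap, .nb a b, .snd, m => if m = b then some a else none
  | .swap, .fst, .snd, m => some m
  | .swap, .snd, .fst, m => some m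
  | .swap, .nb _ _, .nb _ _, m => some m
  | .del, _, _, m => some m
  | _, _, _, _ => none

/-- Whether a vertex with the given letter remains. -/
def Kind.keeps : Kind → Sym → Bool
  | .del, .nb a _ => a
  | _, _ => true

/-- Whether the marked vertices that a word of the given kind needs are there, if `f` and `s` tell
whether the marks `fst` and `snd` occur. -/
def Kind.marked : Kind → Bool → Bool → Bool
  | .lc, f, _ => f
  | .swap, f, s => f && s
  | _, _, _ => true

/-- The kinds of words that are allowed in each phase. -/
def Phase.allows : Phase → Kind → Bool
  | .fresh, .toggle => true
  | .build, .toggle => true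
  | .transform, .lc => true
  | .transform, .swap => true
  | .transform, .del => true
  | _, _ => false

/-- The phase after a word has acted. -/
def Phase.afterRun : Phase → Phase
  | .fresh => .build
  | p => p

/-- The phase after a comparison. -/
def Phase.afterCmp : Phase → Phase
  | .fresh => .transform
  | .build => .transform
  | _ => .done

/-- The matrix entry read from the top of the stack of the current matrix; as long as there is no
matrix, every entry counts as `0`. -/
def readBit : Phase → Option (Option Bool) → Option Bool
  | .fresh, _ => some false
  | _, e => e.join

/-- Whether the symbol read is the end of a row. -/
def isRowEnd : Phase → Option (Option Bool) → Bool
  | .fresh, _ => true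
  | _, some none => true
  | _, _ => false

/-- The progress of a word through the matrix: the part of the current matrix that is still unread,
the part of the new matrix written so far (last symbol first), and whether all checks have
succeeded. -/
structure Acc where
  old : List (Option Bool)
  new : List (Option Bool)
  ok : Bool

/-- The new entry of the matrix in the row of a vertex with letter `s` and the column of another
vertex with letter `s'`. -/
def newEntry (k : Kind) (p : Phase) (s s' : Sym) (e : Option (Option Bool)) : Option Bool :=
  (readBit p e).bind (k.value s s')

/-- Processing the entry in the row of a vertex with letter `s` and the column of another vertex
with letter `s'`. -/
def cell (k : Kind) (p : Phase) (s : Sym) (x : Acc) (s' : Sym) : Acc where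
  old := x.old.tail
  new := if k.keeps s && k.keeps s' then
      some ((newEntry k p s s' x.old.head?).getD false) :: x.new else x.new
  ok := x.ok && (newEntry k p s s' x.old.head?).isSome

/-- Processing a diagonal entry. -/
def diag (k : Kind) (p : Phase) (s : Sym) (x : Acc) : Acc where
  old := x.old.tail
  new := if k.keeps s then some false :: x.new else x.new
  ok := x.ok && decide (readBit p x.old.head? = some false)

/-- Processing the end of a row. -/
def rowEnd (k : Kind) (p : Phase) (s : Sym) (x : Acc) : Acc where
  old := x.old.tail
  new := if k.keeps s then none :: x.new else x.new
  ok := x.ok && isRowEnd p x.old.head?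

/-- Processing the row of a vertex with letter `s`, where `l` and `r` are the letters of the vertices
before and after it. -/
def row (k : Kind) (p : Phase) (l : List Sym) (s : Sym) (r : List Sym) (x : Acc) : Acc :=
  rowEnd k p s (r.foldl (cell k p s) (diag k p s (l.foldl (cell k p s) x)))

/-- Processing the rows of the vertices with letters `r`, where `l` are the letters of the vertices
before them, in reverse order. -/
def rows (k : Kind) (p : Phase) : List Sym → List Sym → Acc → Acc
  | _, [], x => x
  | l, s :: r, x => rows k p (s :: l) r (row k p l.reverse s r x)

/-- The action of a word on a matrix, and whether it is legitimate. -/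
def pass (k : Kind) (p : Phase) (c : List Sym) (M : List (Option Bool)) :
    List (Option Bool) × Bool :=
  let x := rows k p [] c ⟨M, [], true⟩
  (x.new.reverse, x.ok && x.old.isEmpty && k.marked (decide (.fst ∈ c)) (decide (.snd ∈ c)) &&
    p.allows k)

/-- The state of the verification: the phase, whether all checks have succeeded, the current matrix,
the letters read since the last command (last one first), and the rest of the input. -/
structure State where
  phase : Phase
  ok : Bool
  matrix : List (Option Bool)
  word : List Sym
  input : List (Option Bool)

/-- The effect of a symbol of the certificate. -/
def step (S : State) : Cert → State
  | .sym s => { S with word := s :: S.word }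
  | .run k => { S with
      phase := S.phase.afterRun
      ok := S.ok && (pass k S.phase S.word.reverse S.matrix).2
      matrix := (pass k S.phase S.word.reverse S.matrix).1
      word := [] }
  | .cmp => { S with
      phase := S.phase.afterCmp
      ok := S.ok && decide (S.phase ≠ .done) && decide (S.matrix ++ [none] <+: S.input)
      input := S.input.drop (S.matrix.length + 1) }

/-- The state before the certificate is read. -/
def start (x : List (Option Bool)) : State := ⟨.fresh, true, [], [], x⟩

/-- Whether the verification has succeeded. -/
def accepts (S : State) : Bool := S.ok && decide (S.phase = .done) && S.input.isEmpty

/-- The verifier: whether `w` certifies that `x` belongs to ISO-VERTEXMINOR. The certificate makes it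
build the first graph of `x`, transform it into the second one by local complementations, exchanges
and deletions of vertices, and compare the result with `x` after both parts. -/
def verify (q : List (Option Bool) × List Cert) : Bool := accepts (q.2.foldl step (start q.1))

theorem foldl_cell_ok (k : Kind) (p : Phase) (s : Sym) (c : List Sym) (M o : List (Option Bool))
    (a b : Bool) :
    c.foldl (cell k p s) ⟨M, o, a && b⟩ =
      { c.foldl (cell k p s) ⟨M, o, b⟩ with ok := a && (c.foldl (cell k p s) ⟨M, o, b⟩).ok } := by
  induction c generalizing M o b with
  | nil => simp
  | cons d c ih =>
    simp only [List.foldl_cons, cell, Bool.and_assoc]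
    rw [ih]

theorem row_ok (k : Kind) (p : Phase) (l : List Sym) (s : Sym) (r : List Sym)
    (M o : List (Option Bool)) (a b : Bool) :
    row k p l s r ⟨M, o, a && b⟩ =
      { row k p l s r ⟨M, o, b⟩ with ok := a && (row k p l s r ⟨M, o, b⟩).ok } := by
  simp only [row, diag, rowEnd, foldl_cell_ok, Bool.and_assoc]

/-- The failure of an earlier check only affects the flag. The machine keeps one flag for all
checks, whereas `pass` starts with a fresh one. -/
theorem rows_ok (k : Kind) (p : Phase) (l r : List Sym) (M o : List (Option Bool)) (a b : Bool) :
    rows k p l r ⟨M, o, a && b⟩ =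
      { rows k p l r ⟨M, o, b⟩ with ok := a && (rows k p l r ⟨M, o, b⟩).ok } := by
  induction r generalizing l M o b with
  | nil => rfl
  | cons s r ih =>
    rw [rows, rows, row_ok, ih]

theorem length_foldl_cell_old (k : Kind) (p : Phase) (s : Sym) (c : List Sym) (x : Acc) :
    (c.foldl (cell k p s) x).old.length ≤ x.old.length := by
  induction c generalizing x with
  | nil => simp
  | cons d c ih =>
    rw [List.foldl_cons]
    refine (ih _).trans ?_
    simp [cell]

theorem length_foldl_cell_new (k : Kind) (p : Phase) (s : Sym) (c : List Sym) (x : Acc) :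
    (c.foldl (cell k p s) x).new.length ≤ x.new.length + c.length := by
  induction c generalizing x with
  | nil => simp
  | cons d c ih =>
    rw [List.foldl_cons]
    refine (ih _).trans ?_
    simp only [cell, List.length_cons]
    split_ifs <;> grind

theorem length_row_old (k : Kind) (p : Phase) (l : List Sym) (s : Sym) (r : List Sym) (x : Acc) :
    (row k p l s r x).old.length ≤ x.old.length := by
  have h1 := length_foldl_cell_old k p s l x
  have h2 := length_foldl_cell_old k p s r (diag k p s (l.foldl (cell k p s) x))
  simp only [row, rowEnd, List.length_tail]
  simp only [diag, List.length_tail] at h2 ⊢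
  omega

theorem length_row_new (k : Kind) (p : Phase) (l : List Sym) (s : Sym) (r : List Sym) (x : Acc) :
    (row k p l s r x).new.length ≤ x.new.length + (l.length + r.length + 2) := by
  have h1 := length_foldl_cell_new k p s l x
  have h2 := length_foldl_cell_new k p s r (diag k p s (l.foldl (cell k p s) x))
  have h3 : (diag k p s (l.foldl (cell k p s) x)).new.length ≤
      (l.foldl (cell k p s) x).new.length + 1 := by
    simp only [diag]
    split_ifs <;> simp
  simp only [row, rowEnd]
  split_ifs <;> grind

theorem length_rows_old (k : Kind) (p : Phase) (l r : List Sym) (x : Acc) :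
    (rows k p l r x).old.length ≤ x.old.length := by
  induction r generalizing l x with
  | nil => simp [rows]
  | cons s r ih => exact (ih _ _).trans (length_row_old _ _ _ _ _ _)

theorem length_rows_new (k : Kind) (p : Phase) (l r : List Sym) (x : Acc) :
    (rows k p l r x).new.length ≤ x.new.length + r.length * (l.length + r.length + 1) := by
  induction r generalizing l x with
  | nil => simp [rows]
  | cons s r ih =>
    refine (ih _ _).trans ?_
    have := length_row_new k p l.reverse s r x
    simp only [List.length_cons, List.length_reverse] at *
    nlinarith

theorem length_pass (k : Kind) (p : Phase) (c : List Sym) (M : List (Option Bool)) :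
    (pass k p c M).1.length ≤ c.length * (c.length + 1) := by
  have := length_rows_new k p [] c ⟨M, [], true⟩
  simpa [pass] using this

end VertexMinorCertificate

/-! ### A stack program for the verification -/

namespace VertexMinorCertificate

open StackProgram

/-- The alphabet of the stacks. -/
abbrev Symbol := Option Bool ⊕ Cert

/-- The stacks of the verifier: certificate and, at the beginning, input; input; current matrix; new
matrix; two parts of the current word; auxiliary stack. -/
inductive Stack
  | cert
  | input
  | old
  | new
  | left
  | right
  | aux
  deriving DecidableEq

instance : Fintype Stack where
  elems := {.cert, .input, .old, .new, .left, .right, .aux}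
  complete k := by cases k <;> decide

/-- The register of the verifier: the phase, whether all checks have succeeded, whether the marks
`fst` and `snd` occurred in the current word, and the symbols last read from the certificate, for the
row, for the column, and from the matrix or the input. -/
structure Reg where
  phase : Phase
  ok : Bool
  sawFst : Bool
  sawSnd : Bool
  command : Option Symbol
  cur : Option Symbol
  top : Option Symbol
  entry : Option Symbol

noncomputable instance : Fintype Reg :=
  Fintype.ofInjective
    (fun v => (v.phase, v.ok, v.sawFst, v.sawSnd, v.command, v.cur, v.top, v.entry))
    fun v v' h => by cases v; cases v'; simp_all

/-- The matrix entry or input symbol that was read; `none` also stands for an empty stack. -/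
def toEntry : Option Symbol → Option (Option Bool)
  | some (.inl e) => some e
  | _ => none

/-- The letter that was read; the value at other symbols is arbitrary. -/
def toSym : Option Symbol → Sym
  | some (.inr (.sym s)) => s
  | _ => .fst

/-- The kind of word in the command that was read; the value at other symbols is arbitrary. -/
def toKind : Option Symbol → Kind
  | some (.inr (.run k)) => k
  | _ => .toggle

/-- A letter as a stack symbol. -/
def ofSym (s : Sym) : Symbol := .inr (.sym s)

/-- Programs on the stacks of the verifier. -/
abbrev Program := Prog Stack Symbol Reg

/-- Moving the contents of the stack `j` onto the stack `j'`, which reverses their order. -/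
def move (j j' : Stack) : Program :=
  .loop [.pop j fun v a => { v with top := a }, .push j' fun v => v.top] (fun v => v.top.isSome)
    (.ops [])

/-- Emptying a stack. -/
def clear (j : Stack) : Program :=
  .loop [.pop j fun v a => { v with top := a }] (fun v => v.top.isSome) (.ops [])

/-- Processing the entries of one row of the matrix in the columns given by the word on the stack
`j`, which is moved onto `j'`. -/
def scan (j j' : Stack) : Program :=
  .loop [.pop j fun v a => { v with top := a }, .push j' fun v => v.top] (fun v => v.top.isSome)
    (.ops [
      .pop .old fun v a => { v with entry := a },
      .push .new fun v =>
        if (toKind v.command).keeps (toSym v.cur) && (toKind v.command).keeps (toSym v.top) then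
          some (.inl (some ((newEntry (toKind v.command) v.phase (toSym v.cur) (toSym v.top)
            (toEntry v.entry)).getD false))) else none,
      .load fun v => { v with
        ok := v.ok && (newEntry (toKind v.command) v.phase (toSym v.cur) (toSym v.top)
          (toEntry v.entry)).isSome
        entry := none }])

/-- Processing a diagonal entry. -/
def scanDiag : Program :=
  .ops [
    .pop .old fun v a => { v with entry := a },
    .push .new fun v =>
      if (toKind v.command).keeps (toSym v.cur) then some (.inl (some false)) else none,
    .load fun v => { v with
      ok := v.ok && decide (readBit v.phase (toEntry v.entry) = some false)
      entry := none }]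

/-- Processing the end of a row. -/
def scanRowEnd : Program :=
  .ops [
    .pop .old fun v a => { v with entry := a },
    .push .new fun v =>
      if (toKind v.command).keeps (toSym v.cur) then some (.inl none) else none,
    .push .left fun v => v.cur,
    .load fun v => { v with
      ok := v.ok && isRowEnd v.phase (toEntry v.entry)
      sawFst := v.sawFst || decide (toSym v.cur = .fst)
      sawSnd := v.sawSnd || decide (toSym v.cur = .snd)
      entry := none }]

/-- Processing the row of the current vertex. The letters of the vertices before it are on `left`,
last one on top, those of the vertices after it on `right`, first one on top. -/
def scanRow : Program :=
  .seq (move .left .aux) <| .seq (scan .aux .left) <| .seq scanDiag <|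
    .seq (scan .right .aux) <| .seq (move .aux .right) scanRowEnd

/-- Processing all rows. -/
def scanRows : Program :=
  .loop [.pop .right fun v a => { v with cur := a }] (fun v => v.cur.isSome) scanRow

/-- The action of a word on the matrix. -/
def runPass : Program :=
  .seq (move .left .right) <| .seq scanRows <|
    .seq (.ops [
      .pop .old fun v a => { v with entry := a },
      .load fun v => { v with
        ok := v.ok && v.entry.isNone && (toKind v.command).marked v.sawFst v.sawSnd &&
          v.phase.allows (toKind v.command)
        phase := v.phase.afterRun
        sawFst := false
        sawSnd := false
        entry := none }]) <|
    .seq (clear .old) <| .seq (clear .left) <| move .new .old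

/-- The comparison of the matrix with the next graph of the input. -/
def runCmp : Program :=
  .seq (.loop [.pop .old fun v a => { v with top := a }, .push .new fun v => v.top]
      (fun v => v.top.isSome)
      (.ops [
        .pop .input fun v a => { v with entry := a },
        .load fun v => { v with
          ok := v.ok && decide (toEntry v.entry = toEntry v.top)
          entry := none }])) <|
    .seq (.ops [
      .pop .input fun v a => { v with entry := a },
      .load fun v => { v with
        ok := v.ok && decide (v.phase ≠ .done) && decide (toEntry v.entry = some none)
        phase := v.phase.afterCmp
        entry := none }]) <|
    move .new .old

/-- Whether a letter was read. -/
def isSym : Option Symbol → Bool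
  | some (.inr (.sym _)) => true
  | _ => false

/-- Whether a command to let a word act was read. -/
def isRun : Option Symbol → Bool
  | some (.inr (.run _)) => true
  | _ => false

/-- Whether a symbol of the input was read. -/
def isInput : Option Symbol → Bool
  | some (.inl _) => true
  | _ => false

/-- Following the certificate. -/
def mainLoop : Program :=
  .loop [.pop .cert fun v a => { v with command := a }] (fun v => v.command.isSome)
    (.ite (fun v => isSym v.command) (.ops [.push .left fun v => v.command])
      (.ite (fun v => isRun v.command) runPass runCmp))

/-- Separating the input from the certificate. -/
def split : Program :=
  .seq (.loop [.pop .cert fun v a => { v with top := a }] (fun v => isInput v.top)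
      (.ops [.push .aux fun v => v.top])) <|
    .seq (.ops [.push .cert fun v => v.top]) <| move .aux .input

/-- The verifier. -/
def verifier : Program :=
  .seq split <| .seq mainLoop <|
    .seq (.ops [
      .pop .input fun v a => { v with entry := a },
      .load fun v => { v with ok := v.ok && decide (v.phase = .done) && v.entry.isNone }]) <|
    .seq (clear .input) <| .seq (clear .old) (clear .left)

/-- The stacks with the given contents. -/
def contents (c i m n l r t : List Symbol) : Stack → List Symbol
  | .cert => c
  | .input => i
  | .old => m
  | .new => n
  | .left => l
  | .right => r
  | .aux => t

section contents

variable (c i m n l r t x : List Symbol)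

@[simp] theorem contents_cert : contents c i m n l r t .cert = c := rfl
@[simp] theorem contents_input : contents c i m n l r t .input = i := rfl
@[simp] theorem contents_old : contents c i m n l r t .old = m := rfl
@[simp] theorem contents_new : contents c i m n l r t .new = n := rfl
@[simp] theorem contents_left : contents c i m n l r t .left = l := rfl
@[simp] theorem contents_right : contents c i m n l r t .right = r := rfl
@[simp] theorem contents_aux : contents c i m n l r t .aux = t := rfl

@[simp] theorem update_contents_cert :
    Function.update (contents c i m n l r t) .cert x = contents x i m n l r t := by
  funext k; cases k <;> rfl

@[simp] theorem update_contents_input :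
    Function.update (contents c i m n l r t) .input x = contents c x m n l r t := by
  funext k; cases k <;> rfl

@[simp] theorem update_contents_old :
    Function.update (contents c i m n l r t) .old x = contents c i x n l r t := by
  funext k; cases k <;> rfl

@[simp] theorem update_contents_new :
    Function.update (contents c i m n l r t) .new x = contents c i m x l r t := by
  funext k; cases k <;> rfl

@[simp] theorem update_contents_left :
    Function.update (contents c i m n l r t) .left x = contents c i m n x r t := by
  funext k; cases k <;> rfl

@[simp] theorem update_contents_right :
    Function.update (contents c i m n l r t) .right x = contents c i m n l x t := by
  funext k; cases k <;> rfl

@[simp] theorem update_contents_aux :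
    Function.update (contents c i m n l r t) .aux x = contents c i m n l r x := by
  funext k; cases k <;> rfl

end contents

@[simp]
theorem toEntry_head? (M : List (Option Bool)) :
    toEntry (M.map (Sum.inl (β := Cert))).head? = M.head? := by
  cases M <;> rfl

/-- The effect of `move`, where `B p q` are stacks with contents `p` of `j` and `q` of `j'`. -/
theorem exec_move {j j' : Stack} {B : List Symbol → List Symbol → Stack → List Symbol}
    (hj : ∀ p q, B p q j = p) (hj' : ∀ p q, B p q j' = q)
    (uj : ∀ p q x, Function.update (B p q) j x = B x q)
    (uj' : ∀ p q x, Function.update (B p q) j' x = B p x) (v : Reg) (p q : List Symbol) :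
    Exec (move j j') (v, B p q) ({ v with top := none }, B [] (p.reverse ++ q))
      (2 * p.length + 1) := by
  induction p generalizing v q with
  | nil =>
    exact .of_loop_exit (by simp [runOps, Op.run, hj, hj', uj, uj']) rfl
  | cons a p ih =>
    refine .of_loop_iter (s₁ := ({ v with top := some a }, B p (a :: q)))
      (by simp [runOps, Op.run, hj, hj', uj, uj']) rfl (.of_ops rfl) (b := 2 * p.length + 1) ?_
      (by simp; omega)
    rw [List.reverse_cons, List.append_assoc]
    exact ih { v with top := some a } (a :: q)

/-- The effect of `clear`, where `B p` are stacks with contents `p` of `j`. -/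
theorem exec_clear {j : Stack} {B : List Symbol → Stack → List Symbol}
    (hj : ∀ p, B p j = p) (uj : ∀ p x, Function.update (B p) j x = B x) (v : Reg)
    (p : List Symbol) :
    Exec (clear j) (v, B p) ({ v with top := none }, B []) (2 * p.length + 1) := by
  induction p generalizing v with
  | nil =>
    exact .of_loop_exit (by simp [runOps, Op.run, hj, uj]) rfl
  | cons a p ih =>
    refine .of_loop_iter (s₁ := ({ v with top := some a }, B p))
      (by simp [runOps, Op.run, hj, uj]) rfl (.of_ops rfl) (b := 2 * p.length + 1) ?_
      (by simp; omega)
    exact ih { v with top := some a }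

/-- The machine counterpart of folding `cell` along the word `c`, where `B p q m n` are stacks with
contents `p` of `j`, `q` of `j'`, `m` of `old` and `n` of `new`. -/
theorem exec_scan {j j' : Stack}
    {B : List Symbol → List Symbol → List Symbol → List Symbol → Stack → List Symbol}
    (hj : ∀ p q m n, B p q m n j = p) (hj' : ∀ p q m n, B p q m n j' = q)
    (ho : ∀ p q m n, B p q m n .old = m) (hn : ∀ p q m n, B p q m n .new = n)
    (uj : ∀ p q m n x, Function.update (B p q m n) j x = B x q m n)
    (uj' : ∀ p q m n x, Function.update (B p q m n) j' x = B p x m n)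
    (uo : ∀ p q m n x, Function.update (B p q m n) .old x = B p q x n)
    (un : ∀ p q m n x, Function.update (B p q m n) .new x = B p q m x)
    (v : Reg) (he : v.entry = none) (c : List Sym) (q : List Symbol) (x : Acc)
    (hx : v.ok = x.ok) (y : Acc)
    (hy : c.foldl (cell (toKind v.command) v.phase (toSym v.cur)) x = y) :
    Exec (scan j j') (v, B (c.map ofSym) q (x.old.map .inl) (x.new.map .inl))
      ({ v with ok := y.ok, top := none },
        B [] (c.reverse.map ofSym ++ q) (y.old.map .inl) (y.new.map .inl))
      (2 * c.length + 1) := by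
  induction c generalizing v q x with
  | nil =>
    subst hy
    refine .of_loop_exit ?_ rfl
    simp [runOps, Op.run, hj, hj', uj, uj', ← hx]
  | cons s c ih =>
    set x' := cell (toKind v.command) v.phase (toSym v.cur) x s with hx'
    refine .of_loop_iter (s₁ := ({ v with top := some (ofSym s) },
        B (c.map ofSym) (ofSym s :: q) (x.old.map .inl) (x.new.map .inl)))
      (s₂ := ({ v with top := some (ofSym s), ok := x'.ok },
        B (c.map ofSym) (ofSym s :: q) (x'.old.map .inl) (x'.new.map .inl)))
      (by simp [runOps, Op.run, hj, hj', uj, uj']) rfl (.of_ops ?_) (b := 2 * c.length + 1) ?_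
      (by simp; omega)
    · simp only [runOps, Op.run, List.foldl_cons, List.foldl_nil, ho, hn, uo, un, toEntry_head?,
        hx', cell, hx]
      have : toSym (some (ofSym s)) = s := rfl
      simp only [this, he]
      split_ifs <;> simp [List.map_tail]
    · rw [List.reverse_cons, List.map_append, List.append_assoc]
      exact ih { v with top := some (ofSym s), ok := x'.ok } he (ofSym s :: q) x' rfl hy

end VertexMinorCertificate

/-! ### Correctness and running time of the stack program -/

namespace VertexMinorCertificate

open StackProgram

theorem exec_scanRow (v : Reg) (he : v.entry = none) (ht : v.top = none) {s : Sym}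
    (hs : v.cur = some (ofSym s))
    (i j : List Symbol) (l r : List Sym) (x : Acc) (hx : v.ok = x.ok) (y : Acc)
    (hy : row (toKind v.command) v.phase l.reverse s r x = y) :
    Exec scanRow
      (v, contents i j (x.old.map .inl) (x.new.map .inl) (l.map ofSym) (r.map ofSym) [])
      ({ v with
          ok := y.ok
          sawFst := v.sawFst || decide (s = .fst)
          sawSnd := v.sawSnd || decide (s = .snd) },
        contents i j (y.old.map .inl) (y.new.map .inl) ((s :: l).map ofSym) (r.map ofSym) [])
      (4 * (l.length + r.length) + 6) := by
  have hs' : toSym v.cur = s := by rw [hs]; rfl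
  set x₁ := l.reverse.foldl (cell (toKind v.command) v.phase (toSym v.cur)) x with hx₁
  set x₂ := diag (toKind v.command) v.phase s x₁ with hx₂
  set x₃ := r.foldl (cell (toKind v.command) v.phase (toSym v.cur)) x₂ with hx₃
  have e1 := exec_move (j := .left) (j' := .aux)
    (B := fun p q => contents i j (x.old.map .inl) (x.new.map .inl) p (r.map ofSym) q)
    (by simp) (by simp) (by simp) (by simp) v (l.map ofSym) []
  have e2 := exec_scan (j := .aux) (j' := .left)
    (B := fun p q m n => contents i j m n q (r.map ofSym) p)
    (by simp) (by simp) (by simp) (by simp) (by simp) (by simp) (by simp) (by simp)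
    { v with top := none } he l.reverse [] x hx x₁ rfl
  have e3 : Exec scanDiag ({ v with ok := x₁.ok, top := none },
        contents i j (x₁.old.map .inl) (x₁.new.map .inl) (l.map ofSym) (r.map ofSym) [])
      ({ v with ok := x₂.ok, top := none },
        contents i j (x₂.old.map .inl) (x₂.new.map .inl) (l.map ofSym) (r.map ofSym) []) 1 := by
    refine .of_ops ?_
    simp only [runOps, Op.run, List.foldl_cons, List.foldl_nil, contents_old, contents_new,
      update_contents_old, update_contents_new, toEntry_head?, hx₂, diag, hs', he]
    split_ifs <;> simp [List.map_tail]
  have e4 := exec_scan (j := .right) (j' := .aux)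
    (B := fun p q m n => contents i j m n (l.map ofSym) p q)
    (by simp) (by simp) (by simp) (by simp) (by simp) (by simp) (by simp) (by simp)
    { v with ok := x₂.ok, top := none } he r [] x₂ rfl x₃ rfl
  have e5 := exec_move (j := .aux) (j' := .right)
    (B := fun p q => contents i j (x₃.old.map .inl) (x₃.new.map .inl) (l.map ofSym) q p)
    (by simp) (by simp) (by simp) (by simp) { v with ok := x₃.ok, top := none }
    (r.reverse.map ofSym) []
  have e6 : Exec scanRowEnd ({ v with ok := x₃.ok, top := none },
        contents i j (x₃.old.map .inl) (x₃.new.map .inl) (l.map ofSym) (r.map ofSym) [])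
      ({ v with
          ok := y.ok
          sawFst := v.sawFst || decide (s = .fst)
          sawSnd := v.sawSnd || decide (s = .snd) },
        contents i j (y.old.map .inl) (y.new.map .inl) ((s :: l).map ofSym) (r.map ofSym) [])
      1 := by
    refine .of_ops ?_
    have hy' : y = rowEnd (toKind v.command) v.phase s x₃ := by
      rw [← hy, hx₃, hx₂, hx₁, hs']; rfl
    simp only [runOps, Op.run, List.foldl_cons, List.foldl_nil, contents_old, contents_new,
      update_contents_old, update_contents_new, toEntry_head?, hy', rowEnd, hs', he, ht,
      update_contents_left, contents_left]
    split_ifs <;> simp [List.map_tail, hs]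
  simp only [List.append_nil, List.map_reverse, List.reverse_reverse, List.length_map,
    List.length_reverse] at e1 e2 e3 e4 e5 e6
  exact (e1.seq (e2.seq (e3.seq (e4.seq (e5.seq e6))))).weaken (by omega)

theorem exec_scanRows (v : Reg) (he : v.entry = none) (ht : v.top = none)
    (i j : List Symbol) (l r : List Sym) (x : Acc) (hx : v.ok = x.ok) (y : Acc)
    (hy : rows (toKind v.command) v.phase l r x = y) :
    Exec scanRows
      (v, contents i j (x.old.map .inl) (x.new.map .inl) (l.map ofSym) (r.map ofSym) [])
      ({ v with
          ok := y.ok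
          sawFst := v.sawFst || decide (.fst ∈ r)
          sawSnd := v.sawSnd || decide (.snd ∈ r)
          cur := none },
        contents i j (y.old.map .inl) (y.new.map .inl) ((r.reverse ++ l).map ofSym) [] [])
      (r.length * (4 * (l.length + r.length) + 3) + 1) := by
  induction r generalizing v l x with
  | nil =>
    refine .weaken (Nat.le_add_left 1 _) (.of_loop_exit ?_ rfl)
    subst hy
    simp [runOps, Op.run, rows, hx]
  | cons s r ih =>
    set x' := row (toKind v.command) v.phase l.reverse s r x with hx'
    have e1 := exec_scanRow { v with cur := some (ofSym s) } he ht rfl i j l r x hx x' rfl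
    have e2 := ih { v with
      cur := some (ofSym s)
      ok := x'.ok
      sawFst := v.sawFst || decide (s = .fst)
      sawSnd := v.sawSnd || decide (s = .snd) } he ht (s :: l) x' rfl hy
    refine .of_loop_iter (s₁ := ({ v with cur := some (ofSym s) },
      contents i j (x.old.map .inl) (x.new.map .inl) (l.map ofSym) (r.map ofSym) []))
      (by simp [runOps, Op.run]) rfl e1
      (b := r.length * (4 * ((s :: l).length + r.length) + 3) + 1) ?_ ?_
    · have h1 : decide (Sym.fst ∈ s :: r) = (decide (s = .fst) || decide (.fst ∈ r)) := by
        simp [eq_comm]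
      have h2 : decide (Sym.snd ∈ s :: r) = (decide (s = .snd) || decide (.snd ∈ r)) := by
        simp [eq_comm]
      rw [h1, h2, ← Bool.or_assoc, ← Bool.or_assoc, List.reverse_cons, List.append_assoc]
      exact e2
    · simp only [List.length_cons]
      ring_nf
      omega

theorem exec_runPass (v : Reg) (he : v.entry = none) (ht : v.top = none) (hc : v.cur = none)
    (hf : v.sawFst = false) (hs : v.sawSnd = false)
    (i j : List Symbol) (c : List Sym) (M : List (Option Bool)) (N : List (Option Bool) × Bool)
    (hN : pass (toKind v.command) v.phase c.reverse M = N) :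
    Exec runPass
      (v, contents i j (M.map .inl) [] (c.map ofSym) [] [])
      ({ v with
          phase := v.phase.afterRun
          ok := v.ok && N.2 },
        contents i j (N.1.map .inl) [] [] [] [])
      (10 * (c.length + 1) ^ 2 + 2 * M.length) := by
  subst hN
  set x := rows (toKind v.command) v.phase [] c.reverse ⟨M, [], true⟩ with hx
  have e1 := exec_move (j := .left) (j' := .right)
    (B := fun p q => contents i j (M.map .inl) [] p q [])
    (by simp) (by simp) (by simp) (by simp) v (c.map ofSym) []
  have e2 := exec_scanRows v he ht i j [] c.reverse ⟨M, [], v.ok⟩ rfl { x with ok := v.ok && x.ok }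
    (by rw [← Bool.and_true v.ok, rows_ok, Bool.and_true])
  have e3 := Exec.of_ops (l := [
      .pop .old fun (v : Reg) a => { v with entry := a },
      .load fun v => { v with
        ok := v.ok && v.entry.isNone && (toKind v.command).marked v.sawFst v.sawSnd &&
          v.phase.allows (toKind v.command)
        phase := v.phase.afterRun
        sawFst := false
        sawSnd := false
        entry := none }])
      (s := ({ v with
          ok := v.ok && x.ok
          sawFst := v.sawFst || decide (.fst ∈ c.reverse)
          sawSnd := v.sawSnd || decide (.snd ∈ c.reverse)
          cur := none },
        contents i j (x.old.map .inl) (x.new.map .inl) ((c.reverse.reverse ++ []).map ofSym) [] []))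
      (s' := ({ v with
          phase := v.phase.afterRun
          ok := v.ok && (pass (toKind v.command) v.phase c.reverse M).2 },
        contents i j (x.old.tail.map .inl) (x.new.map .inl) (c.map ofSym) [] [])) (by
      simp only [runOps, Op.run, List.foldl_cons, List.foldl_nil, contents_old,
        update_contents_old, hf, hs, he, hc, pass, ← hx, Bool.false_or]
      cases x.old <;> simp [Bool.and_assoc])
  have e4 := exec_clear (j := .old)
    (B := fun p => contents i j p (x.new.map .inl) (c.map ofSym) [] [])
    (by simp) (by simp) { v with
          phase := v.phase.afterRun
          ok := v.ok && (pass (toKind v.command) v.phase c.reverse M).2 } (x.old.tail.map .inl)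
  have e5 := exec_clear (j := .left)
    (B := fun p => contents i j [] (x.new.map .inl) p [] [])
    (by simp) (by simp) { v with
          phase := v.phase.afterRun
          ok := v.ok && (pass (toKind v.command) v.phase c.reverse M).2
          top := none } (c.map ofSym)
  have e6 := exec_move (j := .new) (j' := .old)
    (B := fun p q => contents i j q p [] [] [])
    (by simp) (by simp) (by simp) (by simp) { v with
          phase := v.phase.afterRun
          ok := v.ok && (pass (toKind v.command) v.phase c.reverse M).2
          top := none } (x.new.map .inl) []
  have h1 := length_rows_old (toKind v.command) v.phase [] c.reverse ⟨M, [], true⟩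
  have h2 := length_rows_new (toKind v.command) v.phase [] c.reverse ⟨M, [], true⟩
  rw [← hx] at h1 h2
  -- Reading an empty stack has left `top` as it was.
  have hv : ({ v with top := none } : Reg) = v := by cases v; simp_all
  rw [hv] at e1
  rw [List.append_nil, ← List.map_reverse] at e1 e6
  have hp : x.new.reverse = (pass (toKind v.command) v.phase c.reverse M).1 := rfl
  rw [hp] at e6
  have hv' : ({ v with
      phase := v.phase.afterRun
      ok := v.ok && (pass (toKind v.command) v.phase c.reverse M).2
      top := none } : Reg) = { v with
      phase := v.phase.afterRun
      ok := v.ok && (pass (toKind v.command) v.phase c.reverse M).2 } := by cases v; simp_all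
  rw [hv'] at e4 e5 e6
  refine (e1.seq (e2.seq (e3.seq (e4.seq (e5.seq e6))))).weaken ?_
  simp only [List.length_map, List.length_reverse, List.length_nil, List.length_tail] at *
  ring_nf at *
  omega

/-- A comparison reads the matrix first and the end marker afterwards. -/
theorem append_none_prefix_iff (M X : List (Option Bool)) :
    M ++ [none] <+: X ↔ M <+: X ∧ (X.drop M.length).head? = some none := by
  induction M generalizing X with
  | nil => cases X <;> simp [eq_comm]
  | cons m M ih =>
    cases X with
    | nil => simp
    | cons x X =>
      rw [List.cons_append, List.cons_prefix_cons, List.cons_prefix_cons, ih]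
      simp [and_assoc]

theorem exec_compare (v : Reg) (he : v.entry = none) (i n l : List Symbol)
    (M X : List (Option Bool)) :
    Exec (.loop [.pop .old fun v a => { v with top := a }, .push .new fun v => v.top]
      (fun v => v.top.isSome)
      (.ops [
        .pop .input fun v a => { v with entry := a },
        .load fun v => { v with
          ok := v.ok && decide (toEntry v.entry = toEntry v.top)
          entry := none }]))
      (v, contents i (X.map .inl) (M.map .inl) n l [] [])
      ({ v with ok := v.ok && decide (M <+: X), top := none },
        contents i ((X.drop M.length).map .inl) [] ((M.map .inl).reverse ++ n) l [] [])
      (2 * M.length + 1) := by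
  induction M generalizing v n X with
  | nil => exact .of_loop_exit (by simp [runOps, Op.run]) rfl
  | cons m M ih =>
    refine .of_loop_iter
      (s₁ := ({ v with top := some (.inl m) },
        contents i (X.map .inl) (M.map .inl) (.inl m :: n) l [] []))
      (s₂ := ({ v with top := some (.inl m), ok := v.ok && decide (X.head? = some m) },
        contents i (X.tail.map .inl) (M.map .inl) (.inl m :: n) l [] []))
      (by simp [runOps, Op.run]) rfl (.of_ops ?_) (b := 2 * M.length + 1) ?_ (by simp; omega)
    · simp only [runOps, Op.run, List.foldl_cons, List.foldl_nil, contents_input,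
        update_contents_input, toEntry_head?, he, List.map_tail]
      rfl
    · have h : (v.ok && decide (m :: M <+: X)) =
          (v.ok && decide (X.head? = some m) && decide (M <+: X.tail)) := by
        rw [Bool.and_assoc, ← Bool.decide_and]
        congr 2
        cases X <;> simp [eq_comm]
      have h' : X.drop (m :: M).length = X.tail.drop M.length := by
        cases X <;> simp
      rw [h, h', List.map_cons, List.reverse_cons, List.append_assoc]
      exact ih { v with top := some (.inl m), ok := v.ok && decide (X.head? = some m) } he
        (.inl m :: n) X.tail

theorem exec_runCmp (v : Reg) (he : v.entry = none) (ht : v.top = none)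
    (i l : List Symbol) (M X : List (Option Bool)) :
    Exec runCmp
      (v, contents i (X.map .inl) (M.map .inl) [] l [] [])
      ({ v with
          phase := v.phase.afterCmp
          ok := v.ok && decide (v.phase ≠ .done) && decide (M ++ [none] <+: X) },
        contents i ((X.drop (M.length + 1)).map .inl) (M.map .inl) [] l [] [])
      (4 * M.length + 3) := by
  have e1 := exec_compare v he i [] l M X
  have e2 := Exec.of_ops (l := [
      .pop .input fun (v : Reg) a => { v with entry := a },
      .load fun v => { v with
        ok := v.ok && decide (v.phase ≠ .done) && decide (toEntry v.entry = some none)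
        phase := v.phase.afterCmp
        entry := none }])
      (s := ({ v with ok := v.ok && decide (M <+: X), top := none },
        contents i ((X.drop M.length).map .inl) [] ((M.map .inl).reverse ++ []) l [] []))
      (s' := ({ v with
          phase := v.phase.afterCmp
          ok := v.ok && decide (v.phase ≠ .done) && decide (M ++ [none] <+: X) },
        contents i ((X.drop (M.length + 1)).map .inl) [] ((M.map .inl).reverse ++ []) l [] []))
      (by
        simp only [runOps, Op.run, List.foldl_cons, List.foldl_nil, contents_input,
          update_contents_input, toEntry_head?, he, ht, ← List.map_tail, List.tail_drop]
        congr 2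
        rw [decide_eq_decide.2 (append_none_prefix_iff M X), Bool.decide_and]
        cases v.ok <;> cases decide (v.phase ≠ .done) <;> simp)
  have e3 := exec_move (j := .new) (j' := .old)
    (B := fun p q => contents i ((X.drop (M.length + 1)).map .inl) q p l [] [])
    (by simp) (by simp) (by simp) (by simp) { v with
          phase := v.phase.afterCmp
          ok := v.ok && decide (v.phase ≠ .done) && decide (M ++ [none] <+: X) }
    ((M.map .inl).reverse ++ []) []
  rw [show ({ v with
          phase := v.phase.afterCmp
          ok := v.ok && decide (v.phase ≠ .done) && decide (M ++ [none] <+: X)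
          top := none } : Reg) = { v with
          phase := v.phase.afterCmp
          ok := v.ok && decide (v.phase ≠ .done) && decide (M ++ [none] <+: X) } by
    rw [← ht]] at e3
  simp only [List.append_nil, List.reverse_reverse, List.length_reverse, List.length_map] at e1 e2 e3
  exact (e1.seq (e2.seq e3)).weaken (by omega)

/-- The register at the start of an iteration of the main loop. -/
def regOf (S : State) (a : Option Symbol) : Reg where
  phase := S.phase
  ok := S.ok
  sawFst := false
  sawSnd := false
  command := a
  cur := none
  top := none
  entry := none

/-- The stacks at the start of an iteration of the main loop. -/
def contentsOf (S : State) (w : List Cert) : Stack → List Symbol :=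
  contents (w.map .inr) (S.input.map .inl) (S.matrix.map .inl) [] (S.word.map ofSym) [] []

/-- While a certificate of length `N` is followed, the current word and the rest of the certificate
have length at most `N` together, and so no matrix exceeds `N * (N + 1)` symbols. -/
theorem bound_step {S : State} {N : ℕ} {d : Cert} {m : ℕ} (h1 : S.word.length + (m + 1) ≤ N)
    (h2 : S.matrix.length ≤ N * (N + 1)) :
    (step S d).word.length + m ≤ N ∧ (step S d).matrix.length ≤ N * (N + 1) ∧
      (step S d).input.length ≤ S.input.length := by
  rcases d with s | k | _
  · exact ⟨by simp [step]; omega, h2, le_rfl⟩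
  · refine ⟨by simp [step]; omega, ?_, le_rfl⟩
    have h3 := length_pass k S.phase S.word.reverse S.matrix
    rw [List.length_reverse] at h3
    exact h3.trans (Nat.mul_le_mul (by omega) (by omega))
  · exact ⟨by simp [step]; omega, h2, by simp [step]⟩

theorem bound_foldl_step {S : State} {N : ℕ} {w : List Cert} (h1 : S.word.length + w.length ≤ N)
    (h2 : S.matrix.length ≤ N * (N + 1)) :
    (w.foldl step S).word.length ≤ N ∧ (w.foldl step S).matrix.length ≤ N * (N + 1) ∧
      (w.foldl step S).input.length ≤ S.input.length := by
  induction w generalizing S with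
  | nil => exact ⟨by simpa using h1, h2, le_rfl⟩
  | cons d w ih =>
    obtain ⟨h3, h4, h5⟩ := bound_step (d := d) h1 h2
    obtain ⟨h6, h7, h8⟩ := ih h3 h4
    exact ⟨h6, h7, h8.trans h5⟩

/-- Each symbol of the certificate is dealt with in quadratic time: a word acts in time quadratic in
its length and linear in the size of the matrix. -/
theorem exec_mainLoop {N : ℕ} (w : List Cert) (S : State) (a : Option Symbol)
    (h1 : S.word.length + w.length ≤ N) (h2 : S.matrix.length ≤ N * (N + 1)) :
    Exec mainLoop (regOf S a, contentsOf S w)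
      (regOf (w.foldl step S) none, contentsOf (w.foldl step S) [])
      (w.length * (20 * (N + 1) ^ 2) + 1) := by
  induction w generalizing S a with
  | nil =>
    refine .weaken (Nat.le_add_left 1 _) (.of_loop_exit ?_ rfl)
    simp [runOps, Op.run, regOf, contentsOf]
  | cons d w ih =>
    obtain ⟨h3, h4, -⟩ := bound_step (d := d) h1 h2
    have hw : S.word.length ≤ N := by omega
    have h5 : (S.word.length + 1) ^ 2 ≤ (N + 1) ^ 2 := Nat.pow_le_pow_left (by omega) 2
    refine .of_loop_iter (s₁ := (regOf S (some (.inr d)), contentsOf S w))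
      (s₂ := (regOf (step S d) (some (.inr d)), contentsOf (step S d) w))
      (a := 19 * (N + 1) ^ 2)
      (by simp [runOps, Op.run, regOf, contentsOf]) rfl ?_ (ih (step S d) _ h3 h4) ?_
    · rcases d with s | k | _
      · refine .weaken ?_ (.ite_true rfl (.of_ops ?_))
        · nlinarith
        · simp [runOps, Op.run, regOf, contentsOf, step, ofSym]
      · refine .weaken ?_ (.ite_false rfl (.ite_true rfl
          (exec_runPass (regOf S (some (.inr (.run k)))) rfl rfl rfl rfl rfl _ _ S.word S.matrix
            _ rfl)))
        nlinarith
      · refine .weaken ?_ (.ite_false rfl (.ite_false rfl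
          (exec_runCmp (regOf S (some (.inr .cmp))) rfl rfl _ _ S.matrix S.input)))
        nlinarith
    · simp only [List.length_cons]
      nlinarith

theorem exec_splitLoop (v : Reg) (t : List Symbol) (x : List (Option Bool)) (w : List Cert) :
    Exec (.loop [.pop .cert fun v a => { v with top := a }] (fun v => isInput v.top)
      (.ops [.push .aux fun v => v.top]))
      (v, contents (x.map .inl ++ w.map .inr) [] [] [] [] [] t)
      ({ v with top := (w.map .inr).head? },
        contents (w.map .inr).tail [] [] [] [] [] ((x.map .inl).reverse ++ t))
      (2 * x.length + 1) := by
  induction x generalizing v t with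
  | nil =>
    refine .of_loop_exit (by simp [runOps, Op.run]) ?_
    cases w <;> rfl
  | cons e x ih =>
    refine .of_loop_iter
      (s₁ := ({ v with top := some (.inl e) },
        contents (x.map .inl ++ w.map .inr) [] [] [] [] [] t))
      (s₂ := ({ v with top := some (.inl e) },
        contents (x.map .inl ++ w.map .inr) [] [] [] [] [] (.inl e :: t)))
      (by simp [runOps, Op.run]) rfl (.of_ops (by simp [runOps, Op.run]))
      (b := 2 * x.length + 1) ?_ (by simp; omega)
    rw [List.map_cons, List.reverse_cons, List.append_assoc]
    exact ih { v with top := some (.inl e) } _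

theorem exec_split (x : List (Option Bool)) (w : List Cert) :
    Exec split
      (regOf (start x) none, contents (x.map .inl ++ w.map .inr) [] [] [] [] [] [])
      (regOf (start x) none, contentsOf (start x) w) (4 * x.length + 3) := by
  have e1 := exec_splitLoop (regOf (start x) none) [] x w
  have e2 := Exec.of_ops (l := [.push .cert fun v : Reg => v.top])
    (s := ({ regOf (start x) none with top := (w.map .inr).head? },
        contents (w.map .inr).tail [] [] [] [] [] ((x.map .inl).reverse ++ [])))
    (s' := ({ regOf (start x) none with top := (w.map .inr).head? },
        contents (w.map .inr) [] [] [] [] [] ((x.map .inl).reverse ++ [])))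
    (by cases w <;> simp [runOps, Op.run])
  have e3 := exec_move (j := .aux) (j' := .input)
    (B := fun p q => contents (w.map .inr) q [] [] [] [] p)
    (by simp) (by simp) (by simp) (by simp)
    { regOf (start x) none with top := (w.map .inr).head? } ((x.map .inl).reverse ++ []) []
  simp only [List.append_nil, List.reverse_reverse, List.length_reverse, List.length_map] at e1 e2 e3
  exact (e1.seq (e2.seq e3)).weaken (by omega)

theorem exec_verifier (x : List (Option Bool)) (w : List Cert) :
    ∃ v : Reg, Exec verifier
      (regOf (start []) none,
        Function.update (fun _ => []) .cert (encodeInputCert (x, w)))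
      (v, fun _ => []) (40 * ((encodeInputCert (x, w)).length + 1) ^ 3) ∧
      v.ok = verify (x, w) := by
  set N := (encodeInputCert (x, w)).length with hN
  have hN' : N = x.length + w.length := by simp [hN, encodeInputCert]
  have e0 : Function.update (fun _ => []) Stack.cert (encodeInputCert (x, w)) =
      contents (x.map .inl ++ w.map .inr) [] [] [] [] [] [] := by
    funext k; cases k <;> rfl
  set S := w.foldl step (start x) with hS
  have hb := bound_foldl_step (S := start x) (N := N) (w := w) (by simp [start]; omega)
    (by simp [start])
  rw [← hS] at hb
  obtain ⟨hb1, hb2, hb3⟩ := hb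
  have e1 := exec_split x w
  have e2 := exec_mainLoop (N := N) w (start x) none (by simp [start]; omega) (by simp [start])
  rw [← hS] at e2
  have e3 := Exec.of_ops (l := [
      .pop .input fun (v : Reg) a => { v with entry := a },
      .load fun v => { v with ok := v.ok && decide (v.phase = .done) && v.entry.isNone }])
      (s := (regOf S none, contentsOf S []))
      (s' := ({ regOf S none with ok := accepts S, entry := (S.input.map .inl).head? },
        contents [] (S.input.map .inl).tail (S.matrix.map .inl) [] (S.word.map ofSym) [] []))
      (by
        simp only [runOps, Op.run, List.foldl_cons, List.foldl_nil, contentsOf, contents_input,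
          update_contents_input, regOf, accepts]
        cases S.input <;> simp)
  have e4 := exec_clear (j := .input)
    (B := fun p => contents [] p (S.matrix.map .inl) [] (S.word.map ofSym) [] [])
    (by simp) (by simp) { regOf S none with ok := accepts S, entry := (S.input.map .inl).head? }
    (S.input.map .inl).tail
  have e5 := exec_clear (j := .old)
    (B := fun p => contents [] [] p [] (S.word.map ofSym) [] [])
    (by simp) (by simp) { regOf S none with ok := accepts S, entry := (S.input.map .inl).head? }
    (S.matrix.map .inl)
  have e6 := exec_clear (j := .left)
    (B := fun p => contents [] [] [] [] p [] [])
    (by simp) (by simp) { regOf S none with ok := accepts S, entry := (S.input.map .inl).head? }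
    (S.word.map ofSym)
  have e7 : contents [] [] [] [] [] [] [] = fun _ => [] := by
    funext k; cases k <;> rfl
  rw [e7] at e6
  refine ⟨{ regOf S none with ok := accepts S, entry := (S.input.map .inl).head? }, ?_, rfl⟩
  rw [e0]
  refine (e1.seq (e2.seq (e3.seq (e4.seq (e5.seq e6))))).weaken ?_
  have h3 : S.input.length ≤ N := hb3.trans (by simp [start]; omega)
  have h4 : w.length * (20 * (N + 1) ^ 2) ≤ N * (20 * (N + 1) ^ 2) :=
    Nat.mul_le_mul_right _ (by omega)
  simp only [List.length_map, List.length_tail]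
  have h5 : x.length ≤ N := by omega
  ring_nf at *
  omega

theorem exists_polyTime_verify :
    ∃ M : Turing.TM2ComputableInPolyTime encodeInputCert Computability.encodeBool verify,
      ∀ k, Finite (M.tm.Γ k) := by
  have : Inhabited Symbol := ⟨.inl none⟩
  refine exists_polyTime verifier .cert (regOf (start []) none) Reg.ok encodeInputCert verify
    (40 * (Polynomial.X + 1) ^ 3) fun q => ?_
  obtain ⟨v, hv, h⟩ := exec_verifier q.1 q.2
  exact ⟨v, by simpa using hv, h⟩

end VertexMinorCertificate

/-! ### The action of words on adjacency matrices -/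

namespace VertexMinorCertificate

open SimpleGraph Classical

variable {V : Type*}

/-- The adjacency matrix of the subgraph of `K` induced on the members of `l`, in this order, written
row by row, where each row is followed by `none`. -/
noncomputable def matrix (l : List V) (K : SimpleGraph V) : List (Option Bool) :=
  l.flatMap fun u => (l.map fun w => some (decide (K.Adj u w))) ++ [none]

theorem encodeGraph_eq {n : ℕ} (G : SimpleGraph (Fin n)) :
    encodeGraph G = matrix (List.finRange n) G ++ [none] := rfl

theorem matrix_congr {l : List V} {K K' : SimpleGraph V}
    (h : ∀ u ∈ l, ∀ w ∈ l, (K.Adj u w ↔ K'.Adj u w)) : matrix l K = matrix l K' := by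
  unfold matrix
  refine List.flatMap_congr fun u hu => ?_
  congr 1
  exact List.map_congr_left fun w hw => by rw [decide_eq_decide.2 (h u hu w hw)]

theorem matrix_map {W : Type*} (l : List W) (f : W → V) (K : SimpleGraph V) :
    matrix (l.map f) K = matrix l (K.comap f) := by
  simp [matrix, List.flatMap_map, Function.comp_def]

/-- The matrix records the number of vertices. -/
theorem count_none_matrix (l : List V) (K : SimpleGraph V) :
    (matrix l K).count none = l.length := by
  have h : ∀ p q : List V, (p.flatMap fun u =>
      (q.map fun w => some (decide (K.Adj u w))) ++ [none]).count none = p.length := by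
    intro p q
    induction p with
    | nil => simp
    | cons u p ih =>
      have h0 : (q.map fun w => some (decide (K.Adj u w))).count none = 0 :=
        List.count_eq_zero.2 (by simp)
      rw [List.flatMap_cons, List.count_append, List.count_append, ih, h0]
      simp
      omega
  exact h l l

/-- The symbols that are stored in a given phase: none in the phase `fresh`, in which the verifier
acts as if it read the zero matrix of the size given by the word. -/
def stored : Phase → List (Option Bool) → List (Option Bool)
  | .fresh, _ => []
  | _, M => M

theorem readBit_stored {p : Phase} {b : Bool} (h : p = .fresh → b = false)
    (M : List (Option Bool)) : readBit p (stored p (some b :: M)).head? = some b := by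
  cases p <;> simp_all [readBit, stored]

theorem tail_stored (p : Phase) (e : Option Bool) (M : List (Option Bool)) :
    (stored p (e :: M)).tail = stored p M := by
  cases p <;> rfl

theorem isRowEnd_stored (p : Phase) (M : List (Option Bool)) :
    isRowEnd p (stored p (none :: M)).head? = true := by
  cases p <;> rfl

/-- Processing the columns in `q` of a row with entries `b`. -/
theorem foldl_cell {k : Kind} {p : Phase} {s : Sym} {γ : V → Sym} {b : V → Bool}
    (hb : p = .fresh → ∀ w, b w = false) (q : List V) (M o : List (Option Bool)) (a : Bool) :
    (q.map γ).foldl (cell k p s) ⟨stored p ((q.map fun w => some (b w)) ++ M), o, a⟩ =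
      ⟨stored p M,
        (if k.keeps s then (((q.filter fun w => k.keeps (γ w)).map fun w =>
          some ((k.value s (γ w) (b w)).getD false)).reverse) else []) ++ o,
        a && q.all fun w => (k.value s (γ w) (b w)).isSome⟩ := by
  induction q generalizing o a with
  | nil => simp
  | cons w q ih =>
    rw [List.map_cons, List.map_cons, List.foldl_cons, List.cons_append]
    have hn : newEntry k p s (γ w) (stored p (some (b w) :: ((q.map fun w => some (b w)) ++
        M))).head? = k.value s (γ w) (b w) := by
      rw [newEntry, readBit_stored (fun h => hb h w)]
      rfl
    simp only [cell, hn, tail_stored]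
    rw [ih]
    cases h1 : k.keeps s <;> cases h2 : k.keeps (γ w) <;>
      simp [h2, Bool.and_assoc]

/-- The graph after a word has acted, if `γ` are the letters, before any vertices are deleted. -/
def newGraph (k : Kind) (γ : V → Sym) (K : SimpleGraph V) : SimpleGraph V where
  Adj u w := u ≠ w ∧ (k.value (γ u) (γ w) (decide (K.Adj u w))).getD false = true
  symm := ⟨fun u w h => ⟨h.1.symm, by
    have value_comm : ∀ s s' m, k.value s s' m = k.value s' s m := by
      intro s s' m
      cases k <;> cases s <;> cases s' <;> simp [Kind.value, Bool.and_comm]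
    have h2 := h.2
    rwa [value_comm, decide_eq_decide.2 (K.adj_comm u w)] at h2⟩⟩
  loopless := ⟨fun _ h => h.1 rfl⟩

/-- The letters `γ` are consistent with the adjacencies in `K` of the members of `l`. -/
def Consistent (k : Kind) (γ : V → Sym) (K : SimpleGraph V) (l : List V) : Prop :=
  ∀ u ∈ l, ∀ w ∈ l, u ≠ w → (k.value (γ u) (γ w) (decide (K.Adj u w))).isSome

theorem row_eq {k : Kind} {p : Phase} {γ : V → Sym} {K : SimpleGraph V}
    (hK : p = .fresh → K = ⊥) {l q r : List V} {u : V} (hl : l = q ++ u :: r) (hn : l.Nodup)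
    (M o : List (Option Bool)) (a : Bool) :
    row k p (q.map γ) (γ u) (r.map γ)
        ⟨stored p ((l.map fun w => some (decide (K.Adj u w))) ++ none :: M), o, a⟩ =
      ⟨stored p M,
        (if k.keeps (γ u) then ((l.filter fun w => k.keeps (γ w)).map fun w =>
          some (decide ((newGraph k γ K).Adj u w))) ++ [none] else []).reverse ++ o,
        a && decide (∀ w ∈ l, u ≠ w →
          (k.value (γ u) (γ w) (decide (K.Adj u w))).isSome)⟩ := by
  subst hl
  have hb : p = .fresh → ∀ w, decide (K.Adj u w) = false := by
    intro h w
    simp [hK h]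
  have hq : ∀ w ∈ q, u ≠ w := by
    rintro w hw rfl
    exact (List.disjoint_of_nodup_append hn) hw (by simp)
  have hr : ∀ w ∈ r, u ≠ w := by
    rintro w hw rfl
    have := (List.nodup_cons.1 (List.Nodup.of_append_right hn)).1
    exact this hw
  have hd : ∀ (n : List (Option Bool)) (b : Bool), diag k p (γ u)
      ⟨stored p (some (decide (K.Adj u u)) :: ((r.map fun w => some (decide (K.Adj u w))) ++
        none :: M)), n, b⟩ =
      ⟨stored p ((r.map fun w => some (decide (K.Adj u w))) ++ none :: M),
        if k.keeps (γ u) then some false :: n else n, b⟩ := by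
    intro n b
    simp only [diag, readBit_stored (fun h => hb h u), tail_stored]
    simp
  rw [row, List.map_append, List.map_cons, List.append_assoc, List.cons_append, foldl_cell hb,
    hd, foldl_cell hb]
  simp only [rowEnd, tail_stored, isRowEnd_stored, Bool.and_true]
  have hval : ∀ q' : List V, (∀ w ∈ q', u ≠ w) →
      ((q'.filter fun w => k.keeps (γ w)).map fun w =>
        some ((k.value (γ u) (γ w) (decide (K.Adj u w))).getD false)) =
      ((q'.filter fun w => k.keeps (γ w)).map fun w =>
        some (decide ((newGraph k γ K).Adj u w))) := by
    intro q' hq'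
    refine List.map_congr_left fun w hw => ?_
    simp [newGraph, hq' w (List.mem_filter.1 hw).1]
  rw [hval q hq, hval r hr]
  congr 1
  · cases h : k.keeps (γ u)
    · simp
    · simp [List.filter_append, h]
  · rw [Bool.and_assoc]
    congr 1
    rw [Bool.eq_iff_iff]
    simp only [Bool.and_eq_true, List.all_eq_true, decide_eq_true_eq, List.mem_append,
      List.mem_cons]
    constructor
    · rintro ⟨h1, h2⟩ w (hw | rfl | hw) huw
      · exact h1 w hw
      · exact absurd rfl huw
      · exact h2 w hw
    · intro h
      exact ⟨fun w hw => h w (.inl hw) (hq w hw), fun w hw => h w (.inr (.inr hw)) (hr w hw)⟩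

theorem rows_eq {k : Kind} {p : Phase} {γ : V → Sym} {K : SimpleGraph V}
    (hK : p = .fresh → K = ⊥) {l q r : List V} (hl : l = q ++ r) (hn : l.Nodup)
    (o : List (Option Bool)) (a : Bool) :
    rows k p (q.map γ).reverse (r.map γ)
        ⟨stored p (r.flatMap fun u => (l.map fun w => some (decide (K.Adj u w))) ++ [none]), o, a⟩ =
      ⟨stored p [],
        ((r.filter fun w => k.keeps (γ w)).flatMap fun u =>
          ((l.filter fun w => k.keeps (γ w)).map fun w =>
            some (decide ((newGraph k γ K).Adj u w))) ++ [none]).reverse ++ o,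
        a && decide (∀ u ∈ r, ∀ w ∈ l, u ≠ w →
          (k.value (γ u) (γ w) (decide (K.Adj u w))).isSome)⟩ := by
  induction r generalizing q o a with
  | nil => simp [rows]
  | cons u r ih =>
    rw [List.map_cons, rows, List.reverse_reverse, List.flatMap_cons, List.append_assoc,
      List.singleton_append, row_eq hK hl hn,
      show γ u :: (q.map γ).reverse = ((q ++ [u]).map γ).reverse by simp, ih (by simp [hl])]
    congr 1
    · cases h : k.keeps (γ u) <;> simp [h]
    · rw [Bool.and_assoc, ← Bool.decide_and]
      simp only [List.forall_mem_cons]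

/-- The action of a word on the matrix of a graph. -/
theorem pass_eq {k : Kind} {p : Phase} {γ : V → Sym} {K : SimpleGraph V}
    (hK : p = .fresh → K = ⊥) {l : List V} (hn : l.Nodup) :
    (pass k p (l.map γ) (stored p (matrix l K))).1 =
        matrix (l.filter fun w => k.keeps (γ w)) (newGraph k γ K) ∧
      ((pass k p (l.map γ) (stored p (matrix l K))).2 = true ↔ Consistent k γ K l ∧
        k.marked (decide (.fst ∈ l.map γ)) (decide (.snd ∈ l.map γ)) = true ∧
        p.allows k = true) := by
  have h := rows_eq (γ := γ) (k := k) hK (q := []) (l := l) (r := l) rfl hn [] true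
  rw [List.map_nil, List.reverse_nil] at h
  have h' : stored p [] = [] := by cases p <;> rfl
  unfold pass
  rw [matrix, h]
  refine ⟨?_, ?_⟩
  · simp [matrix]
  · simp [h', Consistent, and_assoc]

/-- Within a row, legitimate processing reads no end of a row. -/
theorem foldl_cell_count {k : Kind} {p : Phase} (hp : p ≠ .fresh) {s : Sym} {c : List Sym} {x : Acc}
    (h : (c.foldl (cell k p s) x).ok = true) :
    x.ok = true ∧ x.old.count none = (c.foldl (cell k p s) x).old.count none := by
  induction c generalizing x with
  | nil => exact ⟨h, rfl⟩
  | cons s' c ih =>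
    obtain ⟨h1, h2⟩ := ih h
    rw [List.foldl_cons, ← h2]
    simp only [cell, Bool.and_eq_true] at h1 ⊢
    refine ⟨h1.1, ?_⟩
    rcases hx : x.old with _ | ⟨_ | b, M⟩
    · rfl
    · rw [hx] at h1
      cases p <;> simp_all [newEntry, readBit]
    · simp

theorem row_count {k : Kind} {p : Phase} (hp : p ≠ .fresh) {l : List Sym} {s : Sym} {r : List Sym}
    {x : Acc} (h : (row k p l s r x).ok = true) :
    x.ok = true ∧ x.old.count none = (row k p l s r x).old.count none + 1 := by
  rw [row] at h ⊢
  set x₁ := l.foldl (cell k p s) x with h1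
  set x₂ := diag k p s x₁ with h2
  set x₃ := r.foldl (cell k p s) x₂ with h3
  have e3 : x₃.ok = true ∧ x₃.old.count none = (rowEnd k p s x₃).old.count none + 1 := by
    simp only [rowEnd, Bool.and_eq_true] at h ⊢
    refine ⟨h.1, ?_⟩
    rcases hx : x₃.old with _ | ⟨_ | b, M⟩ <;> rw [hx] at h <;>
      cases p <;> simp_all [isRowEnd]
  have e2 := foldl_cell_count hp (h3 ▸ e3.1)
  have e1 : x₁.ok = true ∧ x₁.old.count none = x₂.old.count none := by
    have := e2.1
    rw [h2] at this ⊢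
    simp only [diag, Bool.and_eq_true] at this ⊢
    refine ⟨this.1, ?_⟩
    rcases hx : x₁.old with _ | ⟨_ | b, M⟩ <;> rw [hx] at this <;>
      cases p <;> simp_all [readBit]
  have e0 := foldl_cell_count hp (h1 ▸ e1.1)
  refine ⟨e0.1, ?_⟩
  rw [e0.2, ← h1, e1.2, e2.2, ← h3, e3.2]

theorem rows_count {k : Kind} {p : Phase} (hp : p ≠ .fresh) {l r : List Sym} {x : Acc}
    (h : (rows k p l r x).ok = true) :
    x.ok = true ∧ x.old.count none = (rows k p l r x).old.count none + r.length := by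
  induction r generalizing l x with
  | nil => exact ⟨h, rfl⟩
  | cons s r ih =>
    obtain ⟨h1, h2⟩ := ih h
    obtain ⟨h3, h4⟩ := row_count hp h1
    refine ⟨h3, ?_⟩
    rw [h4, h2, List.length_cons, rows]
    omega

/-- A word that acts legitimately has one letter for each row of the matrix. -/
theorem length_eq_of_pass {k : Kind} {p : Phase} (hp : p ≠ .fresh) {c : List Sym}
    {M : List (Option Bool)} (h : (pass k p c M).2 = true) : c.length = M.count none := by
  simp only [pass, Bool.and_eq_true, List.isEmpty_iff] at h
  have := (rows_count hp h.1.1.1).2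
  rw [h.1.1.2] at this
  simpa using this.symm

/-- A word of the right length assigns letters to the vertices. -/
theorem exists_map_eq {l : List V} (hn : l.Nodup) {c : List Sym} (h : c.length = l.length) :
    ∃ γ : V → Sym, c = l.map γ := by
  refine ⟨fun v => c.getD (l.idxOf v) .fst, List.ext_getElem (by simpa using h) ?_⟩
  intro i h1 h2
  simp only [List.length_map] at h2
  simp [hn.idxOf_getElem, h1]

end VertexMinorCertificate

/-! ### Soundness of the verifier -/

namespace VertexMinorCertificate

open SimpleGraph Classical

variable {V : Type*}

/-- A word with `v` marked and the neighbourhood of `v` written on the other vertices performs a local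
complementation. -/
theorem consistent_lc {γ : V → Sym} {K : SimpleGraph V} {l : List V} {v : V}
    (hv : γ v = .fst) (h : ∀ u ∈ l, u ≠ v → ∃ b, γ u = .nb (decide (K.Adj v u)) b) :
    Consistent .lc γ K l ∧
      ∀ u ∈ l, ∀ w ∈ l, (newGraph .lc γ K).Adj u w ↔ (K.localComplement v).Adj u w := by
  have key : ∀ u ∈ l, ∀ w ∈ l, u ≠ w →
      Kind.value .lc (γ u) (γ w) (decide (K.Adj u w)) =
        some (decide ((K.localComplement v).Adj u w)) := by
    intro u hu w hw huw
    simp only [localComplement_adj]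
    by_cases h1 : u = v
    · subst h1
      obtain ⟨b, hb⟩ := h w hw huw.symm
      simp [hv, hb, Kind.value, huw, Xor]
    · obtain ⟨a, ha⟩ := h u hu h1
      by_cases h2 : w = v
      · subst h2
        simp [hv, ha, Kind.value, huw, Xor, K.adj_comm u w]
      · obtain ⟨b, hb⟩ := h w hw h2
        simp only [ha, hb, Kind.value]
        by_cases x1 : K.Adj u w <;> by_cases x2 : K.Adj v u <;> by_cases x3 : K.Adj v w <;>
          simp [x1, x2, x3, huw, Xor]
  refine ⟨fun u hu w hw huw => by rw [key u hu w hw huw]; rfl, fun u hu w hw => ?_⟩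
  by_cases huw : u = w
  · subst huw; simp
  · simp only [newGraph, key u hu w hw huw]
    simp [huw]

/-- A word with `v` and `w` marked and their neighbourhoods written on the other vertices exchanges
`v` and `w`. -/
theorem consistent_swap {γ : V → Sym} {K : SimpleGraph V} {l : List V} {v w : V}
    (hv : γ v = .fst) (hw : γ w = .snd)
    (h : ∀ u ∈ l, u ≠ v → u ≠ w → γ u = .nb (decide (K.Adj v u)) (decide (K.Adj w u))) :
    Consistent .swap γ K l ∧
      ∀ u ∈ l, ∀ u' ∈ l, (newGraph .swap γ K).Adj u u' ↔
        (K.comap (Equiv.swap v w)).Adj u u' := by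
  have hvw : v ≠ w := by
    rintro rfl
    simp [hv] at hw
  have key : ∀ u ∈ l, ∀ u' ∈ l, u ≠ u' →
      Kind.value .swap (γ u) (γ u') (decide (K.Adj u u')) =
        some (decide (K.Adj (Equiv.swap v w u) (Equiv.swap v w u'))) := by
    intro u hu u' hu' huu
    by_cases h1 : u = v
    · subst h1
      rw [Equiv.swap_apply_left]
      by_cases h2 : u' = w
      · subst h2
        simp [hv, hw, Kind.value, K.adj_comm]
      · rw [Equiv.swap_apply_of_ne_of_ne huu.symm h2, hv, h u' hu' huu.symm h2]
        simp [Kind.value]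
    · by_cases h2 : u = w
      · subst h2
        rw [Equiv.swap_apply_right]
        by_cases h3 : u' = v
        · subst h3
          simp [hv, hw, Kind.value, K.adj_comm]
        · rw [Equiv.swap_apply_of_ne_of_ne h3 huu.symm, hw, h u' hu' h3 huu.symm]
          simp [Kind.value]
      · rw [Equiv.swap_apply_of_ne_of_ne h1 h2, h u hu h1 h2]
        by_cases h3 : u' = v
        · subst h3
          simp [hv, Kind.value, K.adj_comm]
        · by_cases h4 : u' = w
          · subst h4
            simp [hw, Kind.value, K.adj_comm]
          · rw [Equiv.swap_apply_of_ne_of_ne h3 h4, h u' hu' h3 h4]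
            simp [Kind.value]
  refine ⟨fun u hu w hw huw => by rw [key u hu w hw huw]; rfl, fun u hu w hw => ?_⟩
  by_cases huw : u = w
  · subst huw; simp
  · simp only [newGraph, key u hu w hw huw]
    simp [huw]

theorem newGraph_del (γ : V → Sym) (K : SimpleGraph V) : newGraph .del γ K = K := by
  ext u w
  simp only [newGraph, Kind.value, Option.getD_some, decide_eq_true_eq]
  exact ⟨fun h => h.2, fun h => ⟨h.ne, h⟩⟩

theorem filter_keeps {k : Kind} (hk : k ≠ .del) (γ : V → Sym) (l : List V) :
    (l.filter fun w => k.keeps (γ w)) = l := by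
  cases k <;> simp_all [Kind.keeps]

/-- Legitimate words in the phase of transformation: up to local complementations, they only rename
and delete vertices. -/
theorem pass_transform {k : Kind} {l : List V} (hl : l.Nodup) {K : SimpleGraph V} {c : List Sym}
    (h : (pass k .transform c (matrix l K)).2 = true) :
    ∃ (l' : List V) (w : List V), l'.Nodup ∧
      (pass k .transform c (matrix l K)).1 = matrix l' (K.localComplements w) := by
  have hc := length_eq_of_pass (by decide) h
  rw [count_none_matrix] at hc
  obtain ⟨γ, rfl⟩ := exists_map_eq hl hc
  have hp := pass_eq (k := k) (p := .transform) (γ := γ) (K := K) (by simp) hl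
  simp only [stored] at hp
  rw [hp.2] at h
  rw [hp.1]
  obtain ⟨h1, h2, h3⟩ := h
  cases k with
  | toggle => simp [Phase.allows] at h3
  | lc =>
    simp only [Kind.marked, decide_eq_true_eq, List.mem_map] at h2
    obtain ⟨v, hv, hγ⟩ := h2
    refine ⟨l, [v], hl, ?_⟩
    rw [filter_keeps (by decide)]
    refine matrix_congr (consistent_lc hγ fun u hu huv => ?_).2
    have := h1 v hv u hu huv.symm
    rw [hγ] at this
    rcases hu' : γ u with _ | _ | ⟨a, b⟩ <;> rw [hu'] at this
    · simp [Kind.value] at this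
    · simp [Kind.value] at this
    · refine ⟨b, ?_⟩
      simp only [Kind.value] at this
      split_ifs at this with h
      · rw [h]
      · simp at this
  | swap =>
    simp only [Kind.marked, Bool.and_eq_true, decide_eq_true_eq, List.mem_map] at h2
    obtain ⟨⟨v, hv, hγ⟩, w, hw, hγ'⟩ := h2
    refine ⟨l.map (Equiv.swap v w), [], hl.map (Equiv.injective _), ?_⟩
    rw [filter_keeps (by decide), matrix_map]
    refine matrix_congr (consistent_swap hγ hγ' fun u hu huv huw => ?_).2
    have e1 := h1 v hv u hu huv.symm
    have e2 := h1 w hw u hu huw.symm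
    rw [hγ] at e1
    rw [hγ'] at e2
    rcases hu' : γ u with _ | _ | ⟨a, b⟩ <;> rw [hu'] at e1 e2
    · simp [Kind.value] at e1
    · simp [Kind.value] at e2
    · simp only [Kind.value] at e1 e2
      split_ifs at e1 e2 with h h'
      · rw [h, h']
      all_goals simp at e1 e2
  | del =>
    exact ⟨_, [], hl.filter _, by rw [newGraph_del]; rfl⟩

/-- Legitimate words in the phases that build the first graph. -/
theorem pass_build {k : Kind} {p : Phase} {n : ℕ} {K : SimpleGraph (Fin n)} {c : List Sym}
    (hp : p = .fresh ∧ n = c.length ∧ K = ⊥ ∨ p = .build)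
    (h : (pass k p c (stored p (matrix (List.finRange n) K))).2 = true) :
    ∃ K' : SimpleGraph (Fin n),
      (pass k p c (stored p (matrix (List.finRange n) K))).1 = matrix (List.finRange n) K' := by
  have hc : c.length = (List.finRange n).length := by
    rcases hp with ⟨-, rfl, -⟩ | rfl
    · simp
    · exact (length_eq_of_pass (by decide) h).trans (count_none_matrix _ _)
  obtain ⟨γ, rfl⟩ := exists_map_eq (List.nodup_finRange n) hc
  have hp' := pass_eq (k := k) (p := p) (γ := γ) (K := K)
    (by rcases hp with ⟨-, -, h⟩ | rfl <;> simp_all) (List.nodup_finRange n)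
  have hk : k = .toggle := by
    have := (hp'.2.1 h).2.2
    rcases hp with ⟨rfl, -⟩ | rfl <;> cases k <;> simp_all [Phase.allows]
  refine ⟨newGraph k γ K, hp'.1.trans ?_⟩
  rw [filter_keeps (by rw [hk]; decide)]

theorem hasIsoVertexMinor_of_list [Finite V] (G : SimpleGraph V) (w : List V) {l : List V}
    (hl : l.Nodup) :
    G.HasIsoVertexMinor ((G.localComplements w).comap l.get) := by
  refine ⟨{v | v ∈ l}, (G.localComplements w).induce {v | v ∈ l}, ⟨⟨hl.getEquiv l, ?_⟩⟩,
    isVertexMinor_localComplements G w _⟩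
  intro a b
  rfl

/-- What is known, as long as all checks have succeeded, about the input `x` and the current matrix
in the course of the verification. -/
def Invariant (x : List (Option Bool)) (S : State) : Prop :=
  match S.phase with
  | .fresh => S.input = x ∧ S.matrix = []
  | .build => S.input = x ∧
      ∃ (n : ℕ) (K : SimpleGraph (Fin n)), S.matrix = matrix (List.finRange n) K
  | .transform => ∃ (n : ℕ) (G : SimpleGraph (Fin n)) (w l : List (Fin n)), l.Nodup ∧
      x = encodeGraph G ++ S.input ∧ S.matrix = matrix l (G.localComplements w)
  | .done => ∃ (n m : ℕ) (G : SimpleGraph (Fin n)) (H : SimpleGraph (Fin m)),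
      x = encodeGraph G ++ encodeGraph H ++ S.input ∧ G.HasIsoVertexMinor H

theorem invariant_step {x : List (Option Bool)} {S : State} (h : S.ok = true → Invariant x S)
    (d : Cert) (hd : (step S d).ok = true) : Invariant x (step S d) := by
  obtain ⟨p, ok, M, c, X⟩ := S
  rcases d with s | k | _
  · exact h hd
  · simp only [step, Bool.and_eq_true] at hd
    obtain ⟨rfl, hd⟩ := hd
    have h := h rfl
    cases p with
    | fresh =>
      obtain ⟨hx, hM⟩ := h
      simp only at hx hM
      subst hx hM
      obtain ⟨K', hK'⟩ := pass_build (k := k) (c := c.reverse) (p := .fresh)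
        (n := c.reverse.length) (K := ⊥) (.inl ⟨rfl, rfl, rfl⟩) hd
      exact ⟨rfl, _, K', hK'⟩
    | build =>
      obtain ⟨hx, n, K, hM⟩ := h
      simp only at hx hM
      subst hx hM
      obtain ⟨K', hK'⟩ := pass_build (k := k) (c := c.reverse) (p := .build) (K := K)
        (.inr rfl) hd
      exact ⟨rfl, n, K', hK'⟩
    | transform =>
      obtain ⟨n, G, w, l, hl, hx, hM⟩ := h
      simp only at hM
      subst hM
      obtain ⟨l', w', hl', h'⟩ := pass_transform hl hd
      exact ⟨n, G, w ++ w', l', hl', hx, by rw [localComplements_append]; exact h'⟩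
    | done => exact h
  · simp only [step, Bool.and_eq_true, decide_eq_true_eq] at hd
    obtain ⟨⟨rfl, hp⟩, X', rfl⟩ := hd
    have h := h rfl
    have hX : (M ++ [none] ++ X').drop (M.length + 1) = X' := by
      rw [List.drop_left' (by simp)]
    cases p with
    | fresh =>
      obtain ⟨hx, hM⟩ := h
      simp only at hx hM
      subst hx hM
      exact ⟨0, ⊥, [], [], List.nodup_nil, by simp [step, encodeGraph_eq, matrix], rfl⟩
    | build =>
      obtain ⟨hx, n, K, hM⟩ := h
      simp only at hx hM
      subst hx hM
      exact ⟨n, K, [], List.finRange n, List.nodup_finRange n, by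
        simp only [step, hX, encodeGraph_eq], rfl⟩
    | transform =>
      obtain ⟨n, G, w, l, hl, hx, hM⟩ := h
      simp only at hM
      subst hM
      refine ⟨n, l.length, G, (G.localComplements w).comap l.get, ?_,
        hasIsoVertexMinor_of_list G w hl⟩
      simp only [step, hX, encodeGraph_eq, hx]
      rw [← matrix_map, List.map_get_finRange]
      simp
    | done => exact absurd rfl hp

/-- Soundness of the verifier. -/
theorem mem_of_verify {x : List (Option Bool)} {w : List Cert} (h : verify (x, w) = true) :
    x ∈ isoVertexMinor := by
  have key : ∀ S, (S.ok = true → Invariant x S) → (w.foldl step S).ok = true →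
      Invariant x (w.foldl step S) := by
    clear h
    induction w with
    | nil => exact fun S h => h
    | cons d w ih => exact fun S h => ih _ (invariant_step h d)
  simp only [verify, accepts, Bool.and_eq_true, decide_eq_true_eq, List.isEmpty_iff] at h
  obtain ⟨⟨h1, h2⟩, h3⟩ := h
  have := key (start x) (fun _ => ⟨rfl, rfl⟩) h1
  unfold Invariant at this
  rw [h2] at this
  obtain ⟨n, m, G, H, hx, hGH⟩ := this
  exact ⟨n, m, G, H, by rw [hx, h3, List.append_nil], hGH⟩

end VertexMinorCertificate

/-! ### Completeness of the verifier -/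

namespace VertexMinorCertificate

open SimpleGraph Classical

/-- The state `S'` can be reached from `S` by at most `t` symbols of a certificate. -/
def Reaches (S S' : State) (t : ℕ) : Prop :=
  ∃ w : List Cert, w.length ≤ t ∧ w.foldl step S = S'

theorem Reaches.refl (S : State) (t : ℕ) : Reaches S S t := ⟨[], Nat.zero_le t, rfl⟩

theorem Reaches.trans {S S' S'' : State} {a b : ℕ} (h : Reaches S S' a) (h' : Reaches S' S'' b) :
    Reaches S S'' (a + b) := by
  obtain ⟨w, hw, rfl⟩ := h
  obtain ⟨w', hw', rfl⟩ := h'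
  exact ⟨w ++ w', by simp; omega, by rw [List.foldl_append]⟩

theorem Reaches.weaken {S S' : State} {a b : ℕ} (hab : a ≤ b) (h : Reaches S S' a) :
    Reaches S S' b := by
  obtain ⟨w, hw, h⟩ := h
  exact ⟨w, hw.trans hab, h⟩

theorem foldl_step_sym (c c' : List Sym) (p : Phase) (b : Bool) (M X : List (Option Bool)) :
    (c.map Cert.sym).foldl step ⟨p, b, M, c', X⟩ = ⟨p, b, M, c.reverse ++ c', X⟩ := by
  induction c generalizing c' with
  | nil => rfl
  | cons s c ih =>
    rw [List.map_cons, List.foldl_cons, List.reverse_cons, List.append_assoc]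
    exact ih (s :: c')

/-- A legitimate word and the command after it. -/
theorem reaches_pass {V : Type*} {k : Kind} {p : Phase} {l : List V} (hl : l.Nodup)
    {K : SimpleGraph V} (hK : p = .fresh → K = ⊥) {γ : V → Sym} (hγ : Consistent k γ K l)
    (hm : k.marked (decide (.fst ∈ l.map γ)) (decide (.snd ∈ l.map γ)) = true)
    (ha : p.allows k = true) (X : List (Option Bool)) :
    Reaches ⟨p, true, stored p (matrix l K), [], X⟩
      ⟨p.afterRun, true, matrix (l.filter fun w => k.keeps (γ w)) (newGraph k γ K), [], X⟩
      (l.length + 1) := by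
  obtain ⟨h1, h2⟩ := pass_eq (k := k) (γ := γ) hK hl
  refine ⟨(l.map γ).map .sym ++ [.run k], by simp, ?_⟩
  rw [List.foldl_append, foldl_step_sym, List.append_nil]
  simp only [List.foldl_cons, List.foldl_nil, step, List.reverse_reverse, h1]
  rw [h2.2 ⟨hγ, hm, ha⟩]
  rfl

/-- A word without marks complements the edges within the set described by the first bits. -/
theorem consistent_toggle {V : Type*} {γ : V → Sym} {f : V → Bool} (h : ∀ v, γ v = .nb (f v) false)
    (K : SimpleGraph V) (l : List V) :
    Consistent .toggle γ K l ∧ ∀ u w, (newGraph .toggle γ K).Adj u w ↔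
      u ≠ w ∧ Xor (K.Adj u w) (f u = true ∧ f w = true) := by
  constructor
  · intro u _ w _ _
    simp [h, Kind.value]
  · intro u w
    simp only [newGraph, h, Kind.value, Option.getD_some]
    by_cases h1 : K.Adj u w <;> cases f u <;> cases f w <;> simp [h1, Xor]

theorem reaches_build_bot (n : ℕ) (X : List (Option Bool)) :
    Reaches (start X) ⟨.build, true, matrix (List.finRange n) ⊥, [], X⟩ (n + 1) := by
  obtain ⟨h1, h2⟩ := consistent_toggle (γ := fun _ : Fin n => .nb false false)
    (f := fun _ => false) (fun _ => rfl) ⊥ (List.finRange n)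
  have := reaches_pass (p := .fresh) (List.nodup_finRange n) (fun _ => rfl) h1 rfl rfl X
  rw [filter_keeps (by decide), List.length_finRange] at this
  have e : newGraph .toggle (fun _ : Fin n => .nb false false) ⊥ = ⊥ := by
    ext u w
    rw [h2]
    simp [Xor]
  rw [e] at this
  exact this

/-- The first graph is built edge by edge, one word for each edge. -/
theorem reaches_build_fromEdgeSet {n : ℕ} (s : Finset (Sym2 (Fin n))) (X : List (Option Bool)) :
    Reaches ⟨.build, true, matrix (List.finRange n) ⊥, [], X⟩
      ⟨.build, true, matrix (List.finRange n) (fromEdgeSet (s : Set (Sym2 (Fin n)))), [], X⟩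
      (s.card * (n + 1)) := by
  induction s using Finset.induction_on with
  | empty =>
    rw [Finset.coe_empty, fromEdgeSet_empty]
    exact .refl _ _
  | @insert e s he ih =>
    rw [Finset.card_insert_of_notMem he, Nat.add_mul, Nat.one_mul]
    refine ih.trans ?_
    induction e with | _ a b => ?_
    by_cases hab : a = b
    · have : fromEdgeSet ((insert s(a, b) s : Finset (Sym2 (Fin n))) : Set (Sym2 (Fin n))) =
          fromEdgeSet (s : Set (Sym2 (Fin n))) := by
        ext u w
        simp only [fromEdgeSet_adj, Finset.coe_insert, Set.mem_insert_iff, Sym2.eq_iff]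
        subst hab
        constructor
        · rintro ⟨(⟨rfl, rfl⟩ | ⟨rfl, rfl⟩) | h, h'⟩
          · exact absurd rfl h'
          · exact absurd rfl h'
          · exact ⟨h, h'⟩
        · exact fun h => ⟨.inr h.1, h.2⟩
      rw [this]
      exact .refl _ _
    · obtain ⟨h1, h2⟩ := consistent_toggle
        (γ := fun v : Fin n => .nb (decide (v = a ∨ v = b)) false)
        (f := fun v => decide (v = a ∨ v = b)) (fun _ => rfl)
        (fromEdgeSet (s : Set (Sym2 (Fin n)))) (List.finRange n)
      have := reaches_pass (p := .build) (List.nodup_finRange n) (by simp) h1 rfl rfl X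
      rw [filter_keeps (by decide), List.length_finRange] at this
      have e : newGraph .toggle (fun v : Fin n => .nb (decide (v = a ∨ v = b)) false)
          (fromEdgeSet (s : Set (Sym2 (Fin n)))) =
          fromEdgeSet ((insert s(a, b) s : Finset (Sym2 (Fin n))) : Set (Sym2 (Fin n))) := by
        ext u w
        rw [h2]
        have he' : s(b, a) ∉ s := by rwa [Sym2.eq_swap]
        simp only [fromEdgeSet_adj, Finset.coe_insert, Set.mem_insert_iff, Sym2.eq_iff,
          decide_eq_true_eq, Finset.mem_coe]
        by_cases huw : u = w
        · simp [huw]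
        · by_cases h3 : u = a ∧ w = b ∨ u = b ∧ w = a
          · rcases h3 with ⟨rfl, rfl⟩ | ⟨rfl, rfl⟩ <;> simp [huw, he, he', Xor]
          · have h4 : ¬ ((u = a ∨ u = b) ∧ (w = a ∨ w = b)) := by
              rintro ⟨rfl | rfl, rfl | rfl⟩ <;> simp_all
            simp [huw, h3, h4, Xor]
      rw [e] at this
      exact this

theorem reaches_cmp {p : Phase} (hp : p ≠ .done) (M X : List (Option Bool)) :
    Reaches ⟨p, true, M, [], M ++ [none] ++ X⟩ ⟨p.afterCmp, true, M, [], X⟩ 1 := by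
  refine ⟨[.cmp], le_rfl, ?_⟩
  simp only [List.foldl_cons, List.foldl_nil, step]
  rw [List.drop_left' (by simp)]
  simp [hp]

theorem reaches_localComplement {n : ℕ} (K : SimpleGraph (Fin n)) (v : Fin n)
    (X : List (Option Bool)) :
    Reaches ⟨.transform, true, matrix (List.finRange n) K, [], X⟩
      ⟨.transform, true, matrix (List.finRange n) (K.localComplement v), [], X⟩ (n + 1) := by
  set γ : Fin n → Sym := fun u => if u = v then .fst else .nb (decide (K.Adj v u)) false with hγ
  have hv : γ v = .fst := if_pos rfl
  obtain ⟨h1, h2⟩ := consistent_lc (K := K) (l := List.finRange n) hv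
    fun u _ hu => ⟨false, by simp [hγ, hu]⟩
  have := reaches_pass (p := .transform) (List.nodup_finRange n) (by simp) h1 (by
    simp only [Kind.marked, decide_eq_true_eq, List.mem_map]
    exact ⟨v, List.mem_finRange v, hv⟩) rfl X
  rw [filter_keeps (by decide), List.length_finRange, matrix_congr h2] at this
  exact this

theorem reaches_localComplements {n : ℕ} (K : SimpleGraph (Fin n)) (w : List (Fin n))
    (X : List (Option Bool)) :
    Reaches ⟨.transform, true, matrix (List.finRange n) K, [], X⟩
      ⟨.transform, true, matrix (List.finRange n) (K.localComplements w), [], X⟩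
      (w.length * (n + 1)) := by
  induction w generalizing K with
  | nil => exact .refl _ _
  | cons v w ih =>
    exact ((reaches_localComplement K v X).trans (ih _)).weaken
      (by rw [List.length_cons]; linarith)

theorem reaches_swap {n : ℕ} (K : SimpleGraph (Fin n)) {l : List (Fin n)} (hl : l.Nodup)
    {v w : Fin n} (hv : v ∈ l) (hw : w ∈ l) (X : List (Option Bool)) :
    Reaches ⟨.transform, true, matrix l K, [], X⟩
      ⟨.transform, true, matrix (l.map (Equiv.swap v w)) K, [], X⟩ (l.length + 1) := by
  by_cases hvw : v = w
  · subst hvw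
    simp only [Equiv.swap_self, Equiv.coe_refl, List.map_id]
    exact .refl _ _
  set γ : Fin n → Sym := fun u => if u = v then .fst else if u = w then .snd else
    .nb (decide (K.Adj v u)) (decide (K.Adj w u)) with hγ
  have hγv : γ v = .fst := if_pos rfl
  have hγw : γ w = .snd := by simp [hγ, Ne.symm hvw]
  obtain ⟨h1, h2⟩ := consistent_swap (K := K) (l := l) hγv hγw
    fun u _ hu hu' => by simp [hγ, hu, hu']
  have := reaches_pass (p := .transform) hl (by simp) h1 (by
    simp only [Kind.marked, Bool.and_eq_true, decide_eq_true_eq, List.mem_map]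
    exact ⟨⟨v, hv, hγv⟩, w, hw, hγw⟩) rfl X
  rw [filter_keeps (by decide), matrix_congr h2, ← matrix_map] at this
  convert this <;> rfl

/-- Any `m` vertices can be moved to the first places by `m` exchanges. -/
theorem reaches_perm {n m : ℕ} (hmn : m ≤ n) (K : SimpleGraph (Fin n)) {f : Fin m → Fin n}
    (hf : Function.Injective f) (X : List (Option Bool)) (k : ℕ) (hk : k ≤ m) :
    ∃ σ : Equiv.Perm (Fin n), (∀ i : Fin m, i < k → σ (Fin.castLE hmn i) = f i) ∧
      Reaches ⟨.transform, true, matrix (List.finRange n) K, [], X⟩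
        ⟨.transform, true, matrix ((List.finRange n).map σ) K, [], X⟩ (k * (n + 1)) := by
  induction k with
  | zero =>
    refine ⟨1, by simp, ?_⟩
    rw [Equiv.Perm.coe_one, List.map_id]
    exact .refl _ _
  | succ k ih =>
    obtain ⟨σ, h1, h2⟩ := ih (by omega)
    set i₀ : Fin m := ⟨k, hk⟩ with hi₀
    have hmem : ∀ v, v ∈ (List.finRange n).map σ := fun v =>
      List.mem_map.2 ⟨σ.symm v, List.mem_finRange _, by simp⟩
    have h3 := reaches_swap K ((List.nodup_finRange n).map σ.injective)
      (hmem (σ (Fin.castLE hmn i₀))) (hmem (f i₀)) X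
    refine ⟨σ.trans (Equiv.swap (σ (Fin.castLE hmn i₀)) (f i₀)), ?_, ?_⟩
    · intro i hi
      by_cases hik : i = i₀
      · subst hik
        simp
      · have hlt : (i : ℕ) < k := by
          have : (i : ℕ) ≠ k := fun h => hik (Fin.ext h)
          omega
        rw [Equiv.trans_apply, h1 i hlt, Equiv.swap_apply_of_ne_of_ne]
        · rw [← h1 i hlt]
          intro h
          exact hik ((Fin.castLE_injective hmn) (σ.injective h))
        · exact fun h => hik (hf h)
    · rw [List.map_map, List.length_map, List.length_finRange] at h3
      exact (h2.trans h3).weaken (by linarith)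

theorem filter_finRange_lt {n m : ℕ} (hmn : m ≤ n) :
    (List.finRange n).filter (fun i : Fin n => decide ((i : ℕ) < m)) =
      (List.finRange m).map (Fin.castLE hmn) := by
  refine List.Perm.eq_of_pairwise (le := (· < ·)) (fun a b _ _ h h' => (lt_asymm h h').elim)
    ((List.sortedLT_finRange n).pairwise.filter _)
    (List.pairwise_map.2 ((List.sortedLT_finRange m).pairwise)) ?_
  rw [List.perm_ext_iff_of_nodup ((List.nodup_finRange n).filter _)
    ((List.nodup_finRange m).map (Fin.castLE_injective hmn))]
  intro i
  simp only [List.mem_filter, List.mem_finRange, true_and, decide_eq_true_eq, List.mem_map]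
  exact ⟨fun h => ⟨⟨i, h⟩, rfl⟩, fun ⟨j, hj⟩ => hj ▸ j.2⟩

/-- The vertices in the first `m` places are kept, the others are deleted. -/
theorem reaches_del {n m : ℕ} (hmn : m ≤ n) (K : SimpleGraph (Fin n)) {f : Fin m → Fin n}
    {σ : Equiv.Perm (Fin n)} (hσ : ∀ i : Fin m, σ (Fin.castLE hmn i) = f i)
    (X : List (Option Bool)) :
    Reaches ⟨.transform, true, matrix ((List.finRange n).map σ) K, [], X⟩
      ⟨.transform, true, matrix (List.finRange m) (K.comap f), [], X⟩ (n + 1) := by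
  have h1 : Consistent .del (fun v => Sym.nb (decide (((σ.symm v : Fin n) : ℕ) < m)) false) K
      ((List.finRange n).map σ) := fun u _ w _ _ => rfl
  have := reaches_pass (p := .transform) ((List.nodup_finRange n).map σ.injective) (by simp) h1
    rfl rfl X
  have e : ((List.finRange n).map σ).filter (fun w => Kind.keeps .del
      (Sym.nb (decide (((σ.symm w : Fin n) : ℕ) < m)) false)) = (List.finRange m).map f := by
    rw [List.filter_map]
    simp only [Function.comp_def, Kind.keeps, Equiv.symm_apply_apply]
    rw [filter_finRange_lt hmn, List.map_map]
    exact List.map_congr_left fun i _ => hσ i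
  rw [newGraph_del, e, matrix_map (List.finRange m) f K, List.length_map,
    List.length_finRange] at this
  exact this

/-- Completeness of the verifier. At most `n ^ 2 + 3 * n + 2` words of `n` letters suffice: one for
the empty graph, one for each edge, at most `2 * n` for local complementations, `m ≤ n` for exchanges
and one for the deletions. There are two comparisons, and the input is longer than `n`. -/
theorem exists_certificate {n m : ℕ} {G : SimpleGraph (Fin n)} {H : SimpleGraph (Fin m)}
    (h : G.HasIsoVertexMinor H) :
    ∃ w : List Cert, w.length ≤ 4 * ((encodeGraph G ++ encodeGraph H).length + 1) ^ 3 ∧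
      verify (encodeGraph G ++ encodeGraph H, w) = true := by
  obtain ⟨S, H', ⟨φ⟩, hH'⟩ := h
  obtain ⟨w, rfl⟩ := hH'.exists_localComplements
  obtain ⟨w', hw', e⟩ := LocalEquivalence.exists_short_word G w
  rw [← e] at φ
  rw [Fintype.card_fin] at hw'
  set f : Fin m → Fin n := fun i => (φ i : Fin n) with hf
  have hinj : Function.Injective f := fun i j hij => φ.injective (Subtype.ext hij)
  have hmn : m ≤ n := by simpa using Fintype.card_le_of_injective f hinj
  have hH : (G.localComplements w').comap f = H := by
    ext i j
    exact φ.map_rel_iff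
  obtain ⟨σ, hσ, hr⟩ := reaches_perm hmn (G.localComplements w') hinj (encodeGraph H) m le_rfl
  have r1 := reaches_build_bot n (encodeGraph G ++ encodeGraph H)
  have r2 := reaches_build_fromEdgeSet G.edgeFinset (encodeGraph G ++ encodeGraph H)
  rw [coe_edgeFinset, fromEdgeSet_edgeSet] at r2
  have r3 := reaches_cmp (p := .build) (by decide) (matrix (List.finRange n) G) (encodeGraph H)
  have r4 := reaches_localComplements G w' (encodeGraph H)
  have r5 := reaches_del hmn (G.localComplements w') (fun i => hσ i i.2) (encodeGraph H)
  rw [hH] at r5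
  have r6 := reaches_cmp (p := .transform) (by decide) (matrix (List.finRange m) H) []
  rw [List.append_nil] at r6
  obtain ⟨c, hc, hfin⟩ := r1.trans (r2.trans (r3.trans (r4.trans (hr.trans (r5.trans r6)))))
  refine ⟨c, hc.trans ?_, ?_⟩
  · have hcard : G.edgeFinset.card ≤ n ^ 2 := by
      have := G.card_edgeFinset_le_card_choose_two
      rw [Fintype.card_fin] at this
      exact this.trans (Nat.choose_le_pow n 2)
    -- The first matrix contains `n` ends of rows and is followed by an end marker.
    have hlen : n + 1 ≤ (encodeGraph G ++ encodeGraph H).length := by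
      have h1 := count_none_matrix (List.finRange n) G
      have h2 := List.count_le_length (a := none) (l := matrix (List.finRange n) G)
      rw [h1, List.length_finRange] at h2
      simp only [encodeGraph_eq, List.length_append, List.length_singleton]
      omega
    set N := (encodeGraph G ++ encodeGraph H).length
    have h1 : G.edgeFinset.card * (n + 1) ≤ n ^ 2 * (n + 1) := Nat.mul_le_mul_right _ hcard
    have h2 : w'.length * (n + 1) ≤ 2 * n * (n + 1) := Nat.mul_le_mul_right _ hw'
    have h3 : m * (n + 1) ≤ n * (n + 1) := Nat.mul_le_mul_right _ hmn
    have h4 : 4 * (n + 2) ^ 3 ≤ 4 * (N + 1) ^ 3 :=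
      Nat.mul_le_mul_left 4 (Nat.pow_le_pow_left (by omega) 3)
    refine le_trans ?_ h4
    ring_nf at *
    omega
  · simp only [verify, hfin, accepts]
    rfl

/-- The verifier decides ISO-VERTEXMINOR with certificates of polynomial length. -/
theorem mem_iff_exists_certificate (x : List (Option Bool)) :
    x ∈ isoVertexMinor ↔
      ∃ w : List Cert, w.length ≤ 4 * (x.length + 1) ^ 3 ∧ verify (x, w) = true := by
  constructor
  · rintro ⟨n, m, G, H, rfl, h⟩
    exact exists_certificate h
  · rintro ⟨w, -, h⟩
    exact mem_of_verify h

end VertexMinorCertificate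

theorem mainTheorem3 : InNP isoVertexMinor := by
  refine ⟨VertexMinorCertificate.Cert, inferInstance, 4 * (Polynomial.X + 1) ^ 3,
    VertexMinorCertificate.verify, VertexMinorCertificate.exists_polyTime_verify, fun x => ?_⟩
  simpa using VertexMinorCertificate.mem_iff_exists_certificate x
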